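/- For an irreducible doubly stochastic matrix $B$ of size at least two, let its (absolute) spectral gap be $$\lambda(B)=\min\{1-|\mu| : \mu\neq 1 \text{ is a complex eigenvalue of } B\}.$$ For $c>0$ and $\alpha\ge 0$, let $\mathcal A_{c,\alpha}$ be the set of symmetric irreducible doubly stochastic matrices $A$ (of any size $k$) with $\lambda(A)\ge c\log^{-\alpha}k$, where $k$ is the size of $A$. For a real $L\ge 1$ and a symmetric doubly stochastic $k\times k$ matrix $A$, the arc-length model $G_L(A)$ is the following random transition matrix. Let $L_1,\dots,L_k$ be independent with the geometric law $P(L_i=m)=(1-\tfrac1L)^{m-1}\tfrac1L$, $m=1,2,\dots$. The states are the pairs $(i,\ell)$ with $1\le i\le k$ and $1\le \ell\le L_i$. From $(i,\ell)$ with $\ell<L_i$ the chain moves to $(i,\ell+1)$ with probability $1$; from $(j,L_j)$ it moves to $(i+1,1)$ with probability $A_{ij}$ for each $i$, where $k+1$ is identified with $1$. **Theorem.** Let $c>0$, $\alpha\ge 0$, $0<\rho_l<\rho_u<\infty$ and $\gamma>7+\alpha$ be constants. Let $k_n\to\infty$ be integers and $L_n\to\infty$ reals such that $\rho_l<\log L_n/\log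 k_n<\rho_u$ for all large $n$, and let $A_n\in\mathcal A_{c,\alpha}$ be of size $k_n\times k_n$ for all large $n$. Then, with probability tending to $1$ as $n\to\infty$, the matrix $G_{L_n}(A_n)$ is irreducible and $$\lambda\bigl(G_{L_n}(A_n)\bigr)\ \ge\ \frac{1}{L_n\log^{\gamma}k_n}.$$ -/

import Mathlib

open Filter Topology MeasureTheory ProbabilityTheory

noncomputable section

/-- The absolute spectral gap `min {1 - |μ| : μ ≠ 1 an eigenvalue of A}` of a real square matrix,
where the eigenvalues are the complex ones. It is used for irreducible doubly stochastic matrices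
of size at least two; they have an eigenvalue other than `1`, and the infimum over the finite
set of eigenvalues is then a minimum. -/
def spectralGap {V : Type*} [Fintype V] [DecidableEq V] (A : Matrix V V ℝ) : ℝ :=
  sInf {r : ℝ | ∃ μ : ℂ, μ ≠ 1 ∧
    Module.End.HasEigenvalue (Matrix.toLin' (A.map (algebraMap ℝ ℂ))) μ ∧ r = 1 - ‖μ‖}

/-- The class of symmetric irreducible doubly stochastic matrices of size `k`
whose spectral gap is at least `c * (log k) ^ (-α)`. -/
structure MemGapClass (c α : ℝ) {k : ℕ} (A : Matrix (Fin k) (Fin k) ℝ) : Prop where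
  symm : A.IsSymm
  doublyStochastic : A ∈ doublyStochastic ℝ (Fin k)
  irreducible : A.IsIrreducible
  gap : c * Real.log k ^ (-α) ≤ spectralGap A

/-- The nodes of the arc-length model with arc lengths `ℓ 0, …, ℓ (k - 1)`: the `i`-th arc has the
`ℓ i` nodes `(i, 0), …, (i, ℓ i - 1)` (positions are counted from `0`). -/
abbrev ArcNode {k : ℕ} (ℓ : Fin k → ℕ) : Type := (i : Fin k) × Fin (ℓ i)

/-- The transition matrix (rows: current node, columns: next node) of the arc-length model with
given arc lengths `ℓ`. A node that is not the last one of its arc moves to the next node of the arc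
with probability one. From the last node of arc `j` the chain moves to the first node of
the arc that follows arc `i` in the cyclic order with probability `A i j`. -/
def arcMatrix {k : ℕ} (A : Matrix (Fin k) (Fin k) ℝ) (ℓ : Fin k → ℕ) :
    Matrix (ArcNode ℓ) (ArcNode ℓ) ℝ :=
  Matrix.of fun u v =>
    if (u.2 : ℕ) + 1 < ℓ u.1 then
      if v.1 = u.1 ∧ (v.2 : ℕ) = (u.2 : ℕ) + 1 then 1 else 0
    else
      if (v.2 : ℕ) = 0 then A ((finRotate k).symm v.1) u.1 else 0

/-- The geometric law of parameter `1 / L` on `{1, 2, …}`, which gives mass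
`(1 - 1 / L) ^ (m - 1) * (1 / L)` to `m`. It is meaningful for `1 ≤ L`; otherwise the parameter is
replaced by the nearest point of `[0, 1]`. -/
def arcLengthLaw (L : ℝ) : Measure ℕ :=
  (geometricMeasure (Set.projIcc 0 1 zero_le_one (1 / L))).map (fun m => m + 1)

/-- The joint law of `k` independent arc lengths, each of geometric law with parameter `1 / L`. -/
def arcLengthsLaw (k : ℕ) (L : ℝ) : Measure (Fin k → ℕ) :=
  Measure.pi fun _ => arcLengthLaw L

end

/-! Along an arc an eigenvector is multiplied by `μ` at each step, so its values `x j` at the arc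
starts satisfy `μ ^ ℓ j * x j = ∑ i, A i j * x (i + 1)`. Suppose `μ ≠ 1` and `1 - ‖μ‖ < τ`, with all
arcs of length at most `M`. Then `‖μ‖ ^ ℓ j ≥ 1 - M * τ`: the left side nearly keeps the norm of
`x`, whereas `A` contracts fluctuations by its gap. Hence `x` is nearly constant
(`arc_solution_near_const`), and the powers `μ ^ ℓ j` are near `1` in quadratic mean
(`arc_solution_sum_pow_sub_one_sq`).

If `arg μ` is not small compared with `1 / L`, this contradicts the spread of the lengths: a tenth
of the powers stay away from `1` (`not_many_pow_far`). If it is small, then `μ ^ ℓ j - 1` is close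
to `ℓ j * w` with `w = log μ`. Double stochasticity gives `∑ j, (μ ^ ℓ j - 1) * x j = 0`, and
near-constancy of `x` then forces `w = 0` (`not_near_one`).

The lengths are regular with high probability. By memorylessness, a set disjoint from its translate
by some `t ≤ L` has mass at most `4/5`; this covers the lengths at most `L`, and those with `sin (θ
* m / 2)` near `0`. A Chernoff bound makes each failure exponentially unlikely in `k`, and a union
over a grid of angles of size polynomial in `k` handles all `θ` at once. -/

noncomputable section

/-! ### Irreducible matrices and eigenvalues -/

namespace Matrix.IsIrreducible

/-- A closed nonempty set of indices of an irreducible matrix is everything. -/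
lemma mem_of_closed {ι : Type*} {A : Matrix ι ι ℝ} (hA : A.IsIrreducible) (T : Set ι)
    (hT : ∀ i ∈ T, ∀ j, 0 < A i j → j ∈ T) {i : ι} (hi : i ∈ T) (j : ι) : j ∈ T := by
  let := A.toQuiver
  obtain ⟨p, -⟩ := hA.connected i j
  induction p with
  | nil => exact hi
  | cons _ e ih => exact hT _ ih _ e.down

/-- A real harmonic function of an irreducible stochastic matrix is constant. -/
lemma eq_of_mulVec_eq {ι : Type*} [Fintype ι] {A : Matrix ι ι ℝ} (hA : A.IsIrreducible)
    (hrow : ∀ i, ∑ j, A i j = 1) {h : ι → ℝ} (hh : ∀ i, ∑ j, A i j * h j = h i) (i j : ι) :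
    h i = h j := by
  have : Nonempty ι := ⟨i⟩
  obtain ⟨m, hm⟩ := Finite.exists_max h
  have key : ∀ j, h j = h m := by
    refine hA.mem_of_closed {j | h j = h m} ?_ (i := m) rfl
    intro a ha b hab
    have hsum : ∑ j, A a j * (h m - h j) = 0 := by
      simp only [mul_sub, Finset.sum_sub_distrib, ← Finset.sum_mul, hrow, hh]
      rw [Set.mem_ofPred_eq] at ha
      rw [ha]; ring
    have h0 := (Finset.sum_eq_zero_iff_of_nonneg (fun j _ =>
      mul_nonneg (hA.nonneg a j) (sub_nonneg.2 (hm j)))).1 hsum b (Finset.mem_univ b)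
    rcases mul_eq_zero.1 h0 with h1 | h1
    · exact absurd h1 hab.ne'
    · exact (sub_eq_zero.1 h1).symm
  rw [key i, key j]

lemma eq_of_mulVec_eq_complex {ι : Type*} [Fintype ι] {A : Matrix ι ι ℝ} (hA : A.IsIrreducible)
    (hrow : ∀ i, ∑ j, A i j = 1) {h : ι → ℂ} (hh : ∀ i, ∑ j, (A i j : ℂ) * h j = h i) (i j : ι) :
    h i = h j := by
  apply Complex.ext
  · exact hA.eq_of_mulVec_eq hrow (h := fun i => (h i).re) (fun i => by
      rw [← hh i]; simp) i j
  · exact hA.eq_of_mulVec_eq hrow (h := fun i => (h i).im) (fun i => by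
      rw [← hh i]; simp) i j

end Matrix.IsIrreducible

lemma Matrix.isIrreducible_of_transGen {ι : Type*} {A : Matrix ι ι ℝ} (h0 : ∀ i j, 0 ≤ A i j)
    (h : ∀ i j, Relation.TransGen (fun a b => 0 < A a b) i j) : A.IsIrreducible := by
  refine ⟨h0, ?_⟩
  let := A.toQuiver
  intro i j
  have := h i j
  induction this with
  | single e => exact ⟨Quiver.Path.nil.cons ⟨e⟩, by simp⟩
  | tail _ e ih =>
    obtain ⟨p, hp⟩ := ih
    exact ⟨p.cons ⟨e⟩, by simp⟩

/-- Every eigenvalue other than `1` respects the spectral gap. -/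
lemma norm_le_one_sub_spectralGap {V : Type*} [Fintype V] [DecidableEq V] {A : Matrix V V ℝ}
    {μ : ℂ} (h1 : μ ≠ 1)
    (hμ : Module.End.HasEigenvalue (Matrix.toLin' (A.map (algebraMap ℝ ℂ))) μ) :
    ‖μ‖ ≤ 1 - spectralGap A := by
  have hfin : {ν : ℂ | Module.End.HasEigenvalue
      (Matrix.toLin' (A.map (algebraMap ℝ ℂ))) ν}.Finite :=
    Module.End.finite_hasEigenvalue _
  have hb : BddBelow {r : ℝ | ∃ μ : ℂ, μ ≠ 1 ∧
      Module.End.HasEigenvalue (Matrix.toLin' (A.map (algebraMap ℝ ℂ))) μ ∧ r = 1 - ‖μ‖} := by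
    refine ((hfin.image fun ν => 1 - ‖ν‖).subset ?_).bddBelow
    rintro r ⟨ν, -, hν, rfl⟩
    exact ⟨ν, hν, rfl⟩
  have := csInf_le hb ⟨μ, h1, hμ, rfl⟩
  unfold spectralGap
  linarith

/-- A real matrix whose trace differs from its size has a complex eigenvalue
other than `1`. -/
lemma exists_eigenvalue_ne_one {V : Type*} [Fintype V] [DecidableEq V] {A : Matrix V V ℝ}
    (h : A.trace ≠ Fintype.card V) :
    ∃ μ : ℂ, μ ≠ 1 ∧ Module.End.HasEigenvalue (Matrix.toLin' (A.map (algebraMap ℝ ℂ))) μ := by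
  by_contra! hcon
  apply h
  set B := A.map (algebraMap ℝ ℂ)
  have hroots : ∀ μ ∈ B.charpoly.roots, μ = 1 := by
    intro μ hμ
    by_contra hne
    refine hcon μ hne ?_
    rw [Module.End.hasEigenvalue_iff_isRoot_charpoly, ← Matrix.toLin'.symm_apply_apply B]
    have := Polynomial.isRoot_of_mem_roots hμ
    simpa using this
  have hrep := Multiset.eq_replicate_of_mem hroots
  have hcard : Multiset.card B.charpoly.roots = Fintype.card V := by
    rw [← (IsAlgClosed.splits B.charpoly).natDegree_eq_card_roots, Matrix.charpoly_natDegree_eq_dim]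
  have htr := Matrix.trace_eq_sum_roots_charpoly (A := B)
  rw [hrep, hcard, Multiset.sum_replicate] at htr
  have h2 : B.trace = ((A.trace : ℝ) : ℂ) := by
    simp [B, Matrix.trace]
  rw [h2] at htr
  have : ((A.trace : ℝ) : ℂ) = ((Fintype.card V : ℝ) : ℂ) := by simpa using htr
  exact_mod_cast this

/-! ### Contraction of fluctuations by the gap -/

/-- The mean of a complex function on a finite type. -/
def mean {ι : Type*} [Fintype ι] (y : ι → ℂ) : ℂ := (∑ i, y i) / Fintype.card ι

lemma sum_sub_mean {ι : Type*} [Fintype ι] [Nonempty ι] (y : ι → ℂ) :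
    ∑ i, (y i - mean y) = 0 := by
  have : (Fintype.card ι : ℂ) ≠ 0 := by simp
  simp only [Finset.sum_sub_distrib, Finset.sum_const, mean, Finset.card_univ, nsmul_eq_mul]
  field_simp
  ring

lemma sum_norm_add_sq {ι : Type*} [Fintype ι] (z : ι → ℂ) (hz : ∑ i, z i = 0) (a : ℂ) :
    ∑ i, ‖a + z i‖ ^ 2 = Fintype.card ι * ‖a‖ ^ 2 + ∑ i, ‖z i‖ ^ 2 := by
  have h (i : ι) : ‖a + z i‖ ^ 2 = ‖a‖ ^ 2 + 2 * (a.re * (z i).re + a.im * (z i).im)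
      + ‖z i‖ ^ 2 := by
    simp only [Complex.sq_norm, Complex.normSq_apply, Complex.add_re, Complex.add_im]
    ring
  have hre : ∑ i, (z i).re = 0 := by rw [← Complex.re_sum, hz]; rfl
  have him : ∑ i, (z i).im = 0 := by rw [← Complex.im_sum, hz]; rfl
  simp only [h, Finset.sum_add_distrib, ← Finset.mul_sum, hre, him]
  simp

lemma sum_norm_sq_eq_mean {ι : Type*} [Fintype ι] [Nonempty ι] (y : ι → ℂ) :
    ∑ i, ‖y i‖ ^ 2 = Fintype.card ι * ‖mean y‖ ^ 2 + ∑ i, ‖y i - mean y‖ ^ 2 := by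
  rw [← sum_norm_add_sq _ (sum_sub_mean y)]
  simp

/-- The contraction form of the spectral gap on the functions of mean zero. -/
lemma sum_norm_sq_mulVec_le {ι : Type*} [Fintype ι] [DecidableEq ι] {A : Matrix ι ι ℝ} {g : ℝ}
    (hsymm : A.IsSymm) (hds : A ∈ doublyStochastic ℝ ι) (hirr : A.IsIrreducible)
    (hgap : g ≤ spectralGap A) (z : ι → ℂ) (hz : ∑ i, z i = 0) :
    ∑ i, ‖∑ j, (A i j : ℂ) * z j‖ ^ 2 ≤ (1 - g) ^ 2 * ∑ i, ‖z i‖ ^ 2 := by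
  set B : Matrix ι ι ℂ := A.map (algebraMap ℝ ℂ) with hB
  have hH : B.IsHermitian := by
    ext i j
    simp [hB, Matrix.conjTranspose_apply, hsymm.apply]
  set b := hH.eigenvectorBasis
  set v : EuclideanSpace ℂ ι := WithLp.toLp 2 z
  set w : EuclideanSpace ℂ ι := WithLp.toLp 2 (B.mulVec z)
  have hw : ∑ i, ‖∑ j, (A i j : ℂ) * z j‖ ^ 2 = ‖w‖ ^ 2 := by
    rw [EuclideanSpace.norm_sq_eq]
    rfl
  have hv : ∑ i, ‖z i‖ ^ 2 = ‖v‖ ^ 2 := by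
    rw [EuclideanSpace.norm_sq_eq]
  rw [hw, hv, ← b.sum_sq_norm_inner_right w, ← b.sum_sq_norm_inner_right v, Finset.mul_sum]
  refine Finset.sum_le_sum fun i _ => ?_
  have hbi : B.mulVec ⇑(b i) = hH.eigenvalues i • ⇑(b i) := hH.mulVec_eigenvectorBasis i
  have hinner : inner ℂ (b i) w = (hH.eigenvalues i : ℂ) * inner ℂ (b i) v := by
    simp only [w, v, EuclideanSpace.inner_eq_star_dotProduct]
    rw [dotProduct_comm, Matrix.dotProduct_mulVec, ← dotProduct_comm z]
    have : Matrix.vecMul (star (⇑(b i))) B = (hH.eigenvalues i : ℂ) • star (⇑(b i)) := by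
      have hs := Matrix.star_mulVec B (⇑(b i))
      rw [hH.eq, hbi] at hs
      rw [← hs]
      ext; simp
    rw [this]
    simp
  rw [hinner, norm_mul, mul_pow]
  have hne : ⇑(b i) ≠ 0 := by
    intro h
    have := b.orthonormal.1 i
    rw [show b i = 0 from by ext j; exact congrFun h j] at this
    simp at this
  by_cases h1 : (hH.eigenvalues i : ℂ) = 1
  -- Irreducibility makes an eigenvector for `1` constant, hence orthogonal to the mean-zero `z`.
  · have hconst := hirr.eq_of_mulVec_eq_complex (sum_row_of_mem_doublyStochastic hds)
      (h := ⇑(b i)) (fun l => by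
        have := congrFun hbi l
        have h1' : hH.eigenvalues i = 1 := by exact_mod_cast h1
        rw [h1', one_smul] at this
        exact this)
    have h0 : inner ℂ (b i) v = 0 := by
      simp only [v, EuclideanSpace.inner_eq_star_dotProduct, dotProduct, Pi.star_apply]
      rcases isEmpty_or_nonempty ι with hE | ⟨⟨i0⟩⟩
      · simp
      · rw [Finset.sum_congr rfl fun l _ => by rw [hconst l i0], ← Finset.sum_mul, hz, zero_mul]
    simp [h0]
  · have hev : Module.End.HasEigenvalue (Matrix.toLin' B) (hH.eigenvalues i : ℂ) := by
      refine Module.End.hasEigenvalue_of_hasEigenvector (x := ⇑(b i)) ⟨?_, hne⟩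
      rw [Module.End.mem_eigenspace_iff, Matrix.toLin'_apply, hbi]
      ext; simp
    have := norm_le_one_sub_spectralGap h1 hev
    gcongr
    linarith

/-- The matrix `A` contracts the fluctuations of functions by the factor `1 - g`. -/
lemma sum_norm_sq_mulVec_add_le {ι : Type*} [Fintype ι] [Nonempty ι] [DecidableEq ι]
    {A : Matrix ι ι ℝ} {g : ℝ}
    (hsymm : A.IsSymm) (hds : A ∈ doublyStochastic ℝ ι) (hirr : A.IsIrreducible)
    (hg0 : 0 ≤ g) (hg1 : g ≤ 1) (hgap : g ≤ spectralGap A) (y : ι → ℂ) :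
    ∑ i, ‖∑ j, (A i j : ℂ) * y j‖ ^ 2 + g * ∑ i, ‖y i - mean y‖ ^ 2 ≤ ∑ i, ‖y i‖ ^ 2 := by
  have hrow : ∀ i, ∑ j, (A i j : ℂ) = 1 := fun i => by
    exact_mod_cast sum_row_of_mem_doublyStochastic hds i
  have hcol : ∀ j, ∑ i, (A i j : ℂ) = 1 := fun i => by
    exact_mod_cast sum_col_of_mem_doublyStochastic hds i
  set z := fun i => y i - mean y with hzdef
  have hz : ∑ i, z i = 0 := sum_sub_mean y
  have h1 : ∀ i, ∑ j, (A i j : ℂ) * y j = mean y + ∑ j, (A i j : ℂ) * z j := fun i => by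
    simp only [hzdef, mul_sub, Finset.sum_sub_distrib, ← Finset.sum_mul, hrow]
    ring
  have hz' : ∑ i, ∑ j, (A i j : ℂ) * z j = 0 := by
    rw [Finset.sum_comm]
    simp only [← Finset.sum_mul, hcol, one_mul, hz]
  simp only [h1]
  rw [sum_norm_add_sq _ hz', sum_norm_sq_eq_mean y]
  have hc := sum_norm_sq_mulVec_le hsymm hds hirr hgap z hz
  have hS : 0 ≤ ∑ i, ‖z i‖ ^ 2 := Finset.sum_nonneg fun i _ => by positivity
  -- Since `0 ≤ g ≤ 1`, `(1 - g) ^ 2 ≤ 1 - g`.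
  nlinarith [mul_nonneg hS (mul_nonneg hg0 (sub_nonneg.2 hg1))]

/-! ### Reduction to the arc starts, and irreducibility -/

section ArcMatrix

variable {k : ℕ} {A : Matrix (Fin k) (Fin k) ℝ} {ℓ : Fin k → ℕ}

/-- The first node of an arc. -/
def arcStart (hℓ : ∀ j, 1 ≤ ℓ j) (j : Fin k) : ArcNode ℓ := ⟨j, 0, hℓ j⟩

lemma sum_arcMatrix_mul_of_lt (u : ArcNode ℓ) (hu : (u.2 : ℕ) + 1 < ℓ u.1) (f : ArcNode ℓ → ℂ) :
    ∑ v, (arcMatrix A ℓ u v : ℂ) * f v = f ⟨u.1, (u.2 : ℕ) + 1, hu⟩ := by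
  rw [Finset.sum_eq_single (⟨u.1, (u.2 : ℕ) + 1, hu⟩ : ArcNode ℓ)]
  · simp [arcMatrix, hu]
  · rintro ⟨j, a⟩ - hne
    have : ¬ (j = u.1 ∧ (a : ℕ) = u.2 + 1) := by
      rintro ⟨rfl, h2⟩
      exact hne (by congr 1; exact Fin.ext h2)
    simp only [arcMatrix, Matrix.of_apply, hu, if_true, this, if_false]
    simp
  · simp

lemma sum_arcMatrix_mul_of_not_lt (hℓ : ∀ j, 1 ≤ ℓ j) (u : ArcNode ℓ)
    (hu : ¬ (u.2 : ℕ) + 1 < ℓ u.1) (f : ArcNode ℓ → ℂ) :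
    ∑ v, (arcMatrix A ℓ u v : ℂ) * f v
      = ∑ i, (A i u.1 : ℂ) * f (arcStart hℓ (finRotate k i)) := by
  rw [Fintype.sum_sigma, ← Equiv.sum_comp (finRotate k)]
  refine Finset.sum_congr rfl fun i _ => ?_
  rw [Finset.sum_eq_single (⟨0, hℓ _⟩ : Fin (ℓ (finRotate k i)))]
  · simp [arcMatrix, hu, arcStart, -finRotate_apply, -finRotate_symm_apply]
  · intro a _ ha
    have : (a : ℕ) ≠ 0 := fun h => ha (Fin.ext h)
    simp [arcMatrix, hu, this]
  · simp

/-- An eigenvector of the arc-length model is determined by its values at the first nodes of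
the arcs, which solve a `k`-dimensional nonlinear eigenvalue problem. -/
lemma exists_arc_solution_of_hasEigenvalue (hℓ : ∀ j, 1 ≤ ℓ j) {μ : ℂ}
    (hμ : Module.End.HasEigenvalue
      (Matrix.toLin' ((arcMatrix A ℓ).map (algebraMap ℝ ℂ))) μ) :
    ∃ x : Fin k → ℂ, x ≠ 0 ∧
      ∀ j, μ ^ ℓ j * x j = ∑ i, (A i j : ℂ) * x (finRotate k i) := by
  obtain ⟨f, hf⟩ := hμ.exists_hasEigenvector
  have hfe : ∀ u, ∑ v, (arcMatrix A ℓ u v : ℂ) * f v = μ * f u := by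
    intro u
    have := congrFun hf.apply_eq_smul u
    rw [Matrix.toLin'_apply] at this
    exact this
  have hpow : ∀ (j : Fin k) (a : ℕ) (ha : a < ℓ j),
      f ⟨j, a, ha⟩ = μ ^ a * f (arcStart hℓ j) := by
    intro j a
    induction a with
    | zero => intro ha; simp [arcStart]
    | succ a ih =>
      intro ha
      have h1 := hfe ⟨j, a, by omega⟩
      rw [sum_arcMatrix_mul_of_lt _ (by exact ha)] at h1
      rw [h1, ih, pow_succ]; ring
  refine ⟨fun j => f (arcStart hℓ j), fun h0 => hf.2 ?_, fun j => ?_⟩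
  · ext ⟨j, a⟩
    have : f (arcStart hℓ j) = 0 := congrFun h0 j
    rw [show (⟨j, a⟩ : ArcNode ℓ) = ⟨j, (a : ℕ), a.2⟩ from rfl, hpow, this]
    simp
  · have hj := hℓ j
    have h1 := hfe ⟨j, ℓ j - 1, by omega⟩
    rw [sum_arcMatrix_mul_of_not_lt hℓ _ (by simp; omega), hpow, ← mul_assoc, ← pow_succ',
      show ℓ j - 1 + 1 = ℓ j by omega] at h1
    exact h1.symm

lemma arcMatrix_nonneg (hA : ∀ i j, 0 ≤ A i j) (u v : ArcNode ℓ) : 0 ≤ arcMatrix A ℓ u v := by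
  simp only [arcMatrix, Matrix.of_apply]
  split_ifs <;> simp [hA]

lemma arcMatrix_reach_of_le {j : Fin k} {a b : ℕ} (hab : a ≤ b) (hb : b < ℓ j) :
    Relation.ReflTransGen (fun u v => 0 < arcMatrix A ℓ u v)
      ⟨j, a, hab.trans_lt hb⟩ ⟨j, b, hb⟩ := by
  induction b, hab using Nat.le_induction with
  | base => exact .refl
  | succ b hab ih =>
    exact (ih (by omega)).tail (by simp [arcMatrix, hb])

/-- One step between arcs lifts to the arc-length model. -/
lemma arcMatrix_step (hℓ : ∀ j, 1 ≤ ℓ j) {i j : Fin k} (h : 0 < A i j) (u : ArcNode ℓ)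
    (hu : u.1 = j) :
    Relation.TransGen (fun u v => 0 < arcMatrix A ℓ u v) u (arcStart hℓ (finRotate k i)) := by
  subst hu
  obtain ⟨j, a, ha⟩ := u
  have h1 := arcMatrix_reach_of_le (A := A) (j := j) (a := a) (b := ℓ j - 1) (Nat.le_sub_one_of_lt ha) (Nat.sub_one_lt (Nat.one_le_iff_ne_zero.1 (hℓ j)))
  refine Relation.TransGen.tail' h1 ?_
  have : ¬ (ℓ j - 1 + 1 < ℓ j) := by omega
  simpa [-finRotate_apply, -finRotate_symm_apply, arcMatrix, arcStart, this] using h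

/-- The doubly stochastic chain on the arcs is irreducible when the symmetric matrix has a
positive absolute spectral gap. -/
lemma arc_step_transGen [Nonempty (Fin k)] {g : ℝ} (hsymm : A.IsSymm)
    (hds : A ∈ doublyStochastic ℝ (Fin k)) (hirr : A.IsIrreducible) (hg0 : 0 < g) (hg1 : g ≤ 1)
    (hgap : g ≤ spectralGap A) (j j' : Fin k) :
    Relation.TransGen (fun a b => 0 < A ((finRotate k).symm b) a) j j' := by
  classical
  set R : Set (Fin k) :=
    {b | Relation.TransGen (fun a b => 0 < A ((finRotate k).symm b) a) j b} with hR
  have hclosed : ∀ a ∈ R, ∀ i, 0 < A i a → finRotate k i ∈ R := fun a ha i hi =>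
    Relation.TransGen.tail ha (by rwa [Equiv.symm_apply_apply])
  have hnn : ∀ a b, 0 ≤ A a b := fun _ _ => nonneg_of_mem_doublyStochastic hds
  have hrow := sum_row_of_mem_doublyStochastic hds
  have hcol := sum_col_of_mem_doublyStochastic hds
  -- As `R` is closed, `A y` dominates the indicator of `R`; both have the same total, so they
  -- agree.
  set y : Fin k → ℝ := fun i => if finRotate k i ∈ R then 1 else 0 with hy
  have hge : ∀ a, (if a ∈ R then (1 : ℝ) else 0) ≤ ∑ i, A a i * y i := by
    intro a
    split_ifs with ha
    · rw [← hrow a]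
      refine Finset.sum_le_sum fun i _ => ?_
      rcases (hnn a i).eq_or_lt with h0 | h0
      · simp [← h0]
      · rw [hsymm.apply] at h0
        simp [hy, hclosed a ha i h0, -finRotate_apply, -finRotate_symm_apply]
    · exact Finset.sum_nonneg fun i _ => mul_nonneg (hnn _ _) (by simp only [hy]; split_ifs <;> simp)
  have htot : ∑ a, ∑ i, A a i * y i = ∑ a, (if a ∈ R then (1 : ℝ) else 0) := by
    rw [Finset.sum_comm]
    simp only [← Finset.sum_mul, hcol, one_mul]
    exact Equiv.sum_comp (finRotate k) (fun a => if a ∈ R then (1 : ℝ) else 0)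
  have heq : ∀ a, ∑ i, A a i * y i = if a ∈ R then 1 else 0 := fun a =>
    ((Finset.sum_eq_sum_iff_of_le fun a _ => hge a).1 htot.symm a (Finset.mem_univ a)).symm
  have hmain := sum_norm_sq_mulVec_add_le hsymm hds hirr hg0.le hg1 hgap (fun i => (y i : ℂ))
  have hnorm : ∑ a, ‖∑ i, (A a i : ℂ) * (y i : ℂ)‖ ^ 2 = ∑ i, ‖(y i : ℂ)‖ ^ 2 := by
    have h1 : ∀ a, ∑ i, (A a i : ℂ) * (y i : ℂ) = ((if a ∈ R then (1 : ℝ) else 0 : ℝ) : ℂ) :=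
      fun a => by rw [← heq a]; push_cast; rfl
    simp only [h1]
    exact (Equiv.sum_comp (finRotate k)
      (fun a => ‖((if a ∈ R then (1 : ℝ) else 0 : ℝ) : ℂ)‖ ^ 2)).symm
  rw [hnorm] at hmain
  -- `A y` has the norm of `y`, so the gap leaves no room for fluctuation: `y` is constant and `R`
  -- is everything.
  have hzero : ∑ i, ‖(y i : ℂ) - mean (fun i => (y i : ℂ))‖ ^ 2 = 0 :=
    le_antisymm (by nlinarith) (Finset.sum_nonneg fun i _ => by positivity)
  have hconst : ∀ i, (y i : ℂ) = mean (fun i => (y i : ℂ)) := fun i => by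
    have := (Finset.sum_eq_zero_iff_of_nonneg fun i _ => by positivity).1 hzero i
      (Finset.mem_univ i)
    simpa [sub_eq_zero] using this
  obtain ⟨i, hi⟩ : ∃ i, 0 < A i j := by
    by_contra! h
    have := hcol j
    have h2 : ∑ i, A i j ≤ 0 := Finset.sum_nonpos fun i _ => h i
    linarith
  have h1 : y i = 1 := by
    have : finRotate k i ∈ R := Relation.TransGen.single (by rwa [Equiv.symm_apply_apply])
    simp [hy, this, -finRotate_apply, -finRotate_symm_apply]
  have h2 : y ((finRotate k).symm j') = 1 := by
    rw [← h1]
    exact_mod_cast (hconst _).trans (hconst i).symm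
  by_contra hcon
  have : j' ∉ R := hcon
  simp [hy, this, -finRotate_apply, -finRotate_symm_apply] at h2

lemma arcMatrix_isIrreducible [Nonempty (Fin k)] {g : ℝ} (hsymm : A.IsSymm)
    (hds : A ∈ doublyStochastic ℝ (Fin k)) (hirr : A.IsIrreducible) (hg0 : 0 < g) (hg1 : g ≤ 1)
    (hgap : g ≤ spectralGap A) (hℓ : ∀ j, 1 ≤ ℓ j) : (arcMatrix A ℓ).IsIrreducible := by
  refine Matrix.isIrreducible_of_transGen
    (arcMatrix_nonneg fun _ _ => nonneg_of_mem_doublyStochastic hds) ?_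
  rintro u ⟨j, b, hb⟩
  have h1 : Relation.TransGen (fun u v => 0 < arcMatrix A ℓ u v) u (arcStart hℓ j) := by
    clear hb
    have := arc_step_transGen hsymm hds hirr hg0 hg1 hgap u.1 j
    induction this with
    | single h => simpa only [Equiv.apply_symm_apply] using arcMatrix_step hℓ h u rfl
    | tail _ h ih =>
      refine ih.trans ?_
      simpa only [Equiv.apply_symm_apply] using arcMatrix_step hℓ h (arcStart hℓ _) rfl
  exact h1.trans_left (arcMatrix_reach_of_le (Nat.zero_le b) hb)

/-- The infimum of an empty set of reals is `0`, so a positive lower bound on the gap needs an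
eigenvalue other than `1`. The first node of an arc of length at least two has a zero diagonal
entry, which keeps the trace below the size. -/
lemma exists_eigenvalue_ne_one_arcMatrix (hds : A ∈ doublyStochastic ℝ (Fin k))
    {j : Fin k} (hj : 2 ≤ ℓ j) :
    ∃ μ : ℂ, μ ≠ 1 ∧
      Module.End.HasEigenvalue (Matrix.toLin' ((arcMatrix A ℓ).map (algebraMap ℝ ℂ))) μ := by
  refine exists_eigenvalue_ne_one (ne_of_lt ?_)
  have h : ∀ u, arcMatrix A ℓ u u ≤ 1 := fun u => by
    simp only [arcMatrix, Matrix.of_apply]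
    split_ifs
    all_goals first | exact le_rfl | exact zero_le_one | exact le_one_of_mem_doublyStochastic hds
  have h0 : arcMatrix A ℓ ⟨j, 0, by omega⟩ ⟨j, 0, by omega⟩ < 1 := by
    simp [arcMatrix, show 1 < ℓ j by omega]
  calc (arcMatrix A ℓ).trace < ∑ _u : ArcNode ℓ, (1 : ℝ) :=
        Finset.sum_lt_sum (fun u _ => h u) ⟨_, Finset.mem_univ _, h0⟩
    _ = _ := by simp

end ArcMatrix

/-! ### Estimates on the values at the arc starts -/

section ArcSolution

variable {k : ℕ} {A : Matrix (Fin k) (Fin k) ℝ} {ℓ : Fin k → ℕ} {μ : ℂ}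
  {x : Fin k → ℂ} {g : ℝ}

lemma mean_comp_equiv {ι : Type*} [Fintype ι] (e : ι ≃ ι) (y : ι → ℂ) :
    mean (fun i => y (e i)) = mean y := by
  simp only [mean, Equiv.sum_comp e y]

/-- By symmetry the left side of `hx` is `A` applied to the rotated `x`, and rotation changes
neither mean nor norms. -/
lemma arc_solution_energy [Nonempty (Fin k)] (hsymm : A.IsSymm)
    (hds : A ∈ doublyStochastic ℝ (Fin k))
    (hirr : A.IsIrreducible) (hg0 : 0 ≤ g) (hg1 : g ≤ 1) (hgap : g ≤ spectralGap A)
    (hx : ∀ j, μ ^ ℓ j * x j = ∑ i, (A i j : ℂ) * x (finRotate k i)) :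
    ∑ j, ‖μ ^ ℓ j * x j‖ ^ 2 + g * ∑ j, ‖x j - mean x‖ ^ 2 ≤ ∑ j, ‖x j‖ ^ 2 := by
  have h := sum_norm_sq_mulVec_add_le hsymm hds hirr hg0 hg1 hgap (fun i => x (finRotate k i))
  rw [mean_comp_equiv, Equiv.sum_comp (finRotate k) (fun i => ‖x i - mean x‖ ^ 2),
    Equiv.sum_comp (finRotate k) (fun i => ‖x i‖ ^ 2)] at h
  convert h using 5 with j
  rw [hx]
  exact Finset.sum_congr rfl fun i _ => by rw [hsymm.apply]

/-- The same contraction, applied to the rotated `x` minus its mean; `A` fixes constants. -/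
lemma arc_solution_fluctuation [Nonempty (Fin k)] (hsymm : A.IsSymm)
    (hds : A ∈ doublyStochastic ℝ (Fin k))
    (hirr : A.IsIrreducible) (hg0 : 0 ≤ g) (hg1 : g ≤ 1) (hgap : g ≤ spectralGap A)
    (hx : ∀ j, μ ^ ℓ j * x j = ∑ i, (A i j : ℂ) * x (finRotate k i)) :
    ∑ j, ‖μ ^ ℓ j * x j - mean x‖ ^ 2 ≤ ∑ j, ‖x j - mean x‖ ^ 2 := by
  have h := sum_norm_sq_mulVec_add_le hsymm hds hirr hg0 hg1 hgap
    (fun i => x (finRotate k i) - mean x)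
  rw [Equiv.sum_comp (finRotate k) (fun i => ‖x i - mean x‖ ^ 2)] at h
  refine le_trans (le_of_eq ?_) ((le_add_of_nonneg_right (mul_nonneg hg0
    (Finset.sum_nonneg fun i _ => by positivity))).trans h)
  refine Finset.sum_congr rfl fun j _ => ?_
  have hrow : ∑ i, (A j i : ℂ) = 1 := by exact_mod_cast sum_row_of_mem_doublyStochastic hds j
  rw [hx]
  simp only [mul_sub, Finset.sum_sub_distrib, ← Finset.sum_mul, hrow, one_mul]
  congr 3
  exact Finset.sum_congr rfl fun i _ => by rw [hsymm.apply]

lemma arc_solution_sum (hds : A ∈ doublyStochastic ℝ (Fin k))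
    (hx : ∀ j, μ ^ ℓ j * x j = ∑ i, (A i j : ℂ) * x (finRotate k i)) :
    ∑ j, μ ^ ℓ j * x j = ∑ j, x j := by
  have hrow : ∀ i, ∑ j, (A i j : ℂ) = 1 := fun i => by
    exact_mod_cast sum_row_of_mem_doublyStochastic hds i
  simp only [hx]
  rw [Finset.sum_comm]
  simp only [← Finset.sum_mul, hrow, one_mul]
  exact Equiv.sum_comp (finRotate k) x

lemma sum_norm_sq_pos {ι : Type*} [Fintype ι] {y : ι → ℂ} (hy : y ≠ 0) :
    0 < ∑ i, ‖y i‖ ^ 2 := by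
  obtain ⟨i, hi⟩ := Function.ne_iff.1 hy
  exact Finset.sum_pos' (fun i _ => by positivity)
    ⟨i, Finset.mem_univ i, by have := norm_pos_iff.2 hi; positivity⟩

lemma arc_solution_norm_le_one (hx0 : x ≠ 0) (hℓ : ∀ j, 1 ≤ ℓ j)
    (hE : ∑ j, ‖μ ^ ℓ j * x j‖ ^ 2 ≤ ∑ j, ‖x j‖ ^ 2) : ‖μ‖ ≤ 1 := by
  by_contra! h
  have h1 : ∑ j, ‖x j‖ ^ 2 * ‖μ‖ ≤ ∑ j, ‖μ ^ ℓ j * x j‖ ^ 2 := by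
    refine Finset.sum_le_sum fun j _ => ?_
    rw [norm_mul, mul_pow, norm_pow, ← pow_mul, mul_comm]
    gcongr
    exact le_self_pow₀ h.le (by have := hℓ j; omega)
  rw [← Finset.sum_mul] at h1
  nlinarith [sum_norm_sq_pos hx0]

lemma one_sub_le_norm_pow {τ M : ℝ} {m : ℕ} (hτ0 : 0 ≤ τ) (hτ1 : τ ≤ 1) (hμ : 1 - τ ≤ ‖μ‖)
    (hm : m ≤ M) : 1 - M * τ ≤ ‖μ‖ ^ m := by
  have h1 := one_add_mul_le_pow (a := -τ) (by linarith) m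
  have h2 : (1 + -τ) ^ m ≤ ‖μ‖ ^ m := pow_le_pow_left₀ (by linarith) (by linarith) m
  nlinarith

/-- If `|μ|` is close to `1`, the solution is close to a constant. -/
lemma arc_solution_near_const [Nonempty (Fin k)] {ε : ℝ} (hε : 0 ≤ ε) (hεg : 4 * ε ≤ g)
    (hpow : ∀ j, 1 - ε ≤ ‖μ‖ ^ ℓ j)
    (hE : ∑ j, ‖μ ^ ℓ j * x j‖ ^ 2 + g * ∑ j, ‖x j - mean x‖ ^ 2 ≤ ∑ j, ‖x j‖ ^ 2) :
    g * ∑ j, ‖x j - mean x‖ ^ 2 ≤ 4 * ε * (k * ‖mean x‖ ^ 2) := by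
  have h1 : ∑ j, (1 - 2 * ε) * ‖x j‖ ^ 2 ≤ ∑ j, ‖μ ^ ℓ j * x j‖ ^ 2 := by
    refine Finset.sum_le_sum fun j _ => ?_
    rw [norm_mul, mul_pow, norm_pow]
    gcongr
    have := hpow j
    by_cases h : ε ≤ 1
    · nlinarith
    · nlinarith [sq_nonneg (‖μ‖ ^ ℓ j)]
  rw [← Finset.mul_sum] at h1
  have h2 := sum_norm_sq_eq_mean x
  rw [Fintype.card_fin] at h2
  have hZ : 0 ≤ ∑ j, ‖x j - mean x‖ ^ 2 := Finset.sum_nonneg fun i _ => by positivity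
  -- With `Z` the fluctuation, `g Z ≤ 2 ε (k ‖mean x‖² + Z)`, and `4 ε ≤ g` absorbs `2 ε Z` into
  -- half of the left side.
  nlinarith

/-- With zero mean, the bound would make the fluctuation, hence `x`, vanish. -/
lemma arc_solution_mean_ne_zero [Nonempty (Fin k)] (hx0 : x ≠ 0) (hg : 0 < g) {ε : ℝ}
    (hZ : g * ∑ j, ‖x j - mean x‖ ^ 2 ≤ 4 * ε * (k * ‖mean x‖ ^ 2)) : 0 < ‖mean x‖ := by
  by_contra! h
  have h0 : ‖mean x‖ = 0 := le_antisymm h (norm_nonneg _)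
  have hp := sum_norm_sq_pos hx0
  rw [sum_norm_sq_eq_mean, h0] at hp
  rw [h0] at hZ
  norm_num at hp hZ
  nlinarith

/-- All the powers `μ ^ ℓ j` are close to `1` in quadratic mean. -/
lemma arc_solution_sum_pow_sub_one_sq (hr : ‖μ‖ ≤ 1) (hg : 0 < g) {ε : ℝ} (hm : 0 < ‖mean x‖)
    (hW : ∑ j, ‖μ ^ ℓ j * x j - mean x‖ ^ 2 ≤ ∑ j, ‖x j - mean x‖ ^ 2)
    (hZ : g * ∑ j, ‖x j - mean x‖ ^ 2 ≤ 4 * ε * (k * ‖mean x‖ ^ 2)) :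
    g * ∑ j, ‖μ ^ ℓ j - 1‖ ^ 2 ≤ 16 * ε * k := by
  have h1 : ∑ j, ‖μ ^ ℓ j - 1‖ ^ 2 * ‖mean x‖ ^ 2
      ≤ ∑ j, (2 * ‖μ ^ ℓ j * x j - mean x‖ ^ 2 + 2 * ‖x j - mean x‖ ^ 2) := by
    refine Finset.sum_le_sum fun j _ => ?_
    -- Both differences on the right are bounded in quadratic mean by the fluctuation of `x`.
    have e : (μ ^ ℓ j - 1) * mean x
        = (μ ^ ℓ j * x j - mean x) - μ ^ ℓ j * (x j - mean x) := by ring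
    have h2 : ‖μ ^ ℓ j - 1‖ * ‖mean x‖ ≤ ‖μ ^ ℓ j * x j - mean x‖ + ‖x j - mean x‖ := by
      rw [← norm_mul, e]
      refine (norm_sub_le _ _).trans ?_
      gcongr
      rw [norm_mul, norm_pow]
      exact mul_le_of_le_one_left (norm_nonneg _) (pow_le_one₀ (norm_nonneg _) hr)
    rw [← mul_pow]
    calc _ ≤ (‖μ ^ ℓ j * x j - mean x‖ + ‖x j - mean x‖) ^ 2 := by gcongr
      _ ≤ _ := by nlinarith [sq_nonneg (‖μ ^ ℓ j * x j - mean x‖ - ‖x j - mean x‖)]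
  rw [← Finset.sum_mul, Finset.sum_add_distrib, ← Finset.mul_sum, ← Finset.mul_sum] at h1
  have hm2 : 0 < ‖mean x‖ ^ 2 := by positivity
  refine le_of_mul_le_mul_right ?_ hm2
  nlinarith

/-- A positive fraction of the powers away from `1` is impossible. -/
lemma not_many_pow_far [Nonempty (Fin k)] (hg : 0 < g) {ε η : ℝ} (hη : 0 < η) (hεη : 160 * ε < g * η ^ 2)
    (hS : g * ∑ j, ‖μ ^ ℓ j - 1‖ ^ 2 ≤ 16 * ε * k) :
    10 * (Finset.univ.filter fun j => η ≤ ‖μ ^ ℓ j - 1‖).card < k := by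
  by_contra! h
  have hk : (k : ℝ) ≤ 10 * (Finset.univ.filter fun j => η ≤ ‖μ ^ ℓ j - 1‖).card := by
    exact_mod_cast h
  have hk0 : (0 : ℝ) < k := by
    have : 0 < Fintype.card (Fin k) := Fintype.card_pos
    rw [Fintype.card_fin] at this
    exact_mod_cast this
  have h1 : ((Finset.univ.filter fun j => η ≤ ‖μ ^ ℓ j - 1‖).card : ℝ) * η ^ 2
      ≤ ∑ j, ‖μ ^ ℓ j - 1‖ ^ 2 := by
    rw [← nsmul_eq_mul]
    refine (Finset.card_nsmul_le_sum _ (fun j => ‖μ ^ ℓ j - 1‖ ^ 2) _ fun j hj => ?_).trans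
      (Finset.sum_le_sum_of_subset_of_nonneg (Finset.subset_univ _) fun i _ _ => by positivity)
    have := (Finset.mem_filter.1 hj).2
    gcongr
  have h2 : k * η ^ 2 ≤ 10 * ∑ j, ‖μ ^ ℓ j - 1‖ ^ 2 := by nlinarith [sq_nonneg η]
  -- A tenth of the terms at least `η ^ 2` would give `g * η ^ 2 * k ≤ 160 * ε * k`.
  nlinarith

/-- The logarithm of `μ` cannot be small and nonzero. -/
lemma not_near_one [Nonempty (Fin k)] (hg : 0 < g) {ε M L : ℝ} {w : ℂ} (hL : 0 < L) (hw : Complex.exp w = μ)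
    (hw0 : w ≠ 0) (hwM : ‖w‖ * M ≤ 1 / 2) (hM : ∀ j, (ℓ j : ℝ) ≤ M)
    (hlong : k ≤ 10 * (Finset.univ.filter fun j => L < ℓ j).card)
    (hεM : 6400 * M ^ 2 * ε < g * L ^ 2) (hm : 0 < ‖mean x‖)
    (hsum : ∑ j, μ ^ ℓ j * x j = ∑ j, x j)
    (hZ : g * ∑ j, ‖x j - mean x‖ ^ 2 ≤ 4 * ε * (k * ‖mean x‖ ^ 2)) : False := by
  have hk0 : (0 : ℝ) < k := by
    have : 0 < Fintype.card (Fin k) := Fintype.card_pos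
    rw [Fintype.card_fin] at this
    exact_mod_cast this
  have hwp : 0 < ‖w‖ := norm_pos_iff.2 hw0
  have hpow : ∀ j, μ ^ ℓ j = Complex.exp (ℓ j * w) := fun j => by
    rw [Complex.exp_nat_mul, hw]
  have hsmall : ∀ j, ‖(ℓ j : ℂ) * w‖ ≤ 1 / 2 := fun j => by
    rw [norm_mul, Complex.norm_natCast]
    nlinarith [hM j]
  have hlin : ∀ j, ‖μ ^ ℓ j - 1 - ℓ j * w‖ ≤ ‖w‖ * ℓ j / 2 := fun j => by
    rw [hpow]
    refine (Complex.norm_exp_sub_one_sub_id_le ((hsmall j).trans (by norm_num))).trans ?_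
    have h1 := hsmall j
    have h2 : ‖(ℓ j : ℂ) * w‖ = ℓ j * ‖w‖ := by rw [norm_mul, Complex.norm_natCast]
    have h3 := norm_nonneg ((ℓ j : ℂ) * w)
    calc ‖(ℓ j : ℂ) * w‖ ^ 2 ≤ ‖(ℓ j : ℂ) * w‖ * (1 / 2) := by rw [sq]; gcongr
      _ = _ := by rw [h2]; ring
  have hup : ∀ j, ‖μ ^ ℓ j - 1‖ ≤ 2 * M * ‖w‖ := fun j => by
    have h1 : ‖μ ^ ℓ j - 1‖ ≤ ‖μ ^ ℓ j - 1 - ℓ j * w‖ + ‖(ℓ j : ℂ) * w‖ := by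
      simpa using norm_add_le (μ ^ ℓ j - 1 - ℓ j * w) (ℓ j * w)
    rw [norm_mul, Complex.norm_natCast] at h1
    nlinarith [hlin j, hM j, (Nat.cast_nonneg (ℓ j) : (0 : ℝ) ≤ ℓ j)]
  have hS : (k : ℝ) * L ≤ 10 * ∑ j, (ℓ j : ℝ) := by
    have h1 : ((Finset.univ.filter fun j => L < ℓ j).card : ℝ) * L ≤ ∑ j, (ℓ j : ℝ) := by
      rw [← nsmul_eq_mul]
      exact (Finset.card_nsmul_le_sum _ (fun j => (ℓ j : ℝ)) _ fun j hj =>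
        (Finset.mem_filter.1 hj).2.le).trans
        (Finset.sum_le_sum_of_subset_of_nonneg (Finset.subset_univ _) fun i _ _ => by positivity)
    have h2 : (k : ℝ) ≤ 10 * (Finset.univ.filter fun j => L < ℓ j).card := by exact_mod_cast hlong
    nlinarith
  -- The linearization error is at most half of the main term `‖w‖ * ∑ ℓ j`, and `∑ ℓ j ≥ k * L /
  -- 10`.
  have hlow : ‖w‖ * (k * L) / 20 ≤ ‖∑ j, (μ ^ ℓ j - 1)‖ := by
    have e : ∑ j, (ℓ j : ℂ) * w = ∑ j, (μ ^ ℓ j - 1) - ∑ j, (μ ^ ℓ j - 1 - ℓ j * w) := by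
      rw [← Finset.sum_sub_distrib]; simp
    have h1 : ‖∑ j, (ℓ j : ℂ) * w‖ = ‖w‖ * ∑ j, (ℓ j : ℝ) := by
      rw [← Finset.sum_mul, norm_mul, mul_comm]
      congr 1
      rw [← Nat.cast_sum, Complex.norm_natCast, Nat.cast_sum]
    have h2 : ‖∑ j, (μ ^ ℓ j - 1 - ℓ j * w)‖ ≤ ‖w‖ * (∑ j, (ℓ j : ℝ)) / 2 := by
      refine (norm_sum_le _ _).trans ((Finset.sum_le_sum fun j _ => hlin j).trans (le_of_eq ?_))
      rw [← Finset.sum_div, Finset.mul_sum]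
    have h3 := norm_sub_le (∑ j, (μ ^ ℓ j - 1)) (∑ j, (μ ^ ℓ j - 1 - ℓ j * w))
    rw [← e, h1] at h3
    nlinarith
  have hrel : (∑ j, (μ ^ ℓ j - 1)) * mean x = -∑ j, (μ ^ ℓ j - 1) * (x j - mean x) := by
    have : ∑ j, (μ ^ ℓ j - 1) * x j = 0 := by
      simp only [sub_mul, one_mul, Finset.sum_sub_distrib, hsum, sub_self]
    simp only [mul_sub, Finset.sum_sub_distrib, this, ← Finset.sum_mul]
    ring
  have hbound : ‖w‖ * (k * L) / 20 * ‖mean x‖ ≤ 2 * M * ‖w‖ * ∑ j, ‖x j - mean x‖ := by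
    calc _ ≤ ‖∑ j, (μ ^ ℓ j - 1)‖ * ‖mean x‖ := by gcongr
      _ = ‖∑ j, (μ ^ ℓ j - 1) * (x j - mean x)‖ := by rw [← norm_mul, hrel, norm_neg]
      _ ≤ ∑ j, ‖(μ ^ ℓ j - 1) * (x j - mean x)‖ := norm_sum_le _ _
      _ ≤ _ := by
        rw [Finset.mul_sum]
        refine Finset.sum_le_sum fun j _ => ?_
        rw [norm_mul]
        gcongr
        exact hup j
  -- Both sides are proportional to `‖w‖`, so its size is irrelevant once `w ≠ 0`.
  have hb2 : k * L * ‖mean x‖ ≤ 40 * M * ∑ j, ‖x j - mean x‖ := by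
    refine le_of_mul_le_mul_left ?_ hwp
    linarith
  have hcs : (∑ j, ‖x j - mean x‖) ^ 2 ≤ k * ∑ j, ‖x j - mean x‖ ^ 2 := by
    simpa using sq_sum_le_card_mul_sum_sq (s := Finset.univ) (f := fun j => ‖x j - mean x‖)
  have hsq : (k * L * ‖mean x‖) ^ 2 ≤ (40 * M) ^ 2 * (k * ∑ j, ‖x j - mean x‖ ^ 2) := by
    calc _ ≤ (40 * M * ∑ j, ‖x j - mean x‖) ^ 2 := by gcongr
      _ = (40 * M) ^ 2 * (∑ j, ‖x j - mean x‖) ^ 2 := by ring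
      _ ≤ _ := by gcongr
  have hfin : g * (k * L * ‖mean x‖) ^ 2 ≤ 6400 * M ^ 2 * ε * (k * ‖mean x‖) ^ 2 := by
    calc _ ≤ g * ((40 * M) ^ 2 * (k * ∑ j, ‖x j - mean x‖ ^ 2)) := by gcongr
      _ = (40 * M) ^ 2 * k * (g * ∑ j, ‖x j - mean x‖ ^ 2) := by ring
      _ ≤ (40 * M) ^ 2 * k * (4 * ε * (k * ‖mean x‖ ^ 2)) := by gcongr
      _ = _ := by ring
  have hp : 0 < (k * ‖mean x‖) ^ 2 := by positivity
  nlinarith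

end ArcSolution

/-! ### The gap for regular arc lengths -/

/-- Arc lengths that are all between `1` and `M`, a tenth of which exceed `L`, and which do not
concentrate near the multiples of `2π / θ` for any `θ` that is not small compared with `1 / L`. -/
structure RegularLengths {k : ℕ} (M L s η : ℝ) (ℓ : Fin k → ℕ) : Prop where
  one_le : ∀ j, 1 ≤ ℓ j
  le_max : ∀ j, (ℓ j : ℝ) ≤ M
  long : k ≤ 10 * (Finset.univ.filter fun j => L < ℓ j).card
  spread : ∀ θ : ℝ, s / L ≤ |θ| → |θ| ≤ Real.pi →
    k ≤ 10 * (Finset.univ.filter fun j => η ≤ |Real.sin (θ * ℓ j / 2)|).card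

/-- The phase of `μ ^ m` is at distance `2 * |sin|` from `1`, and replacing `μ ^ m` by its phase
costs `1 - ‖μ‖ ^ m`. -/
lemma two_mul_abs_sin_le_norm_pow_sub_one {μ : ℂ} (hr : ‖μ‖ ≤ 1) (m : ℕ) :
    2 * |Real.sin (μ.arg * m / 2)| - (1 - ‖μ‖ ^ m) ≤ ‖μ ^ m - 1‖ := by
  have h1 : μ ^ m = ((‖μ‖ ^ m : ℝ) : ℂ) * Complex.exp (Complex.I * ((μ.arg * m : ℝ) : ℂ)) := by
    conv_lhs => rw [← Complex.norm_mul_exp_arg_mul_I μ]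
    rw [mul_pow, ← Complex.exp_nat_mul]
    push_cast
    congr 2
    ring
  set u := Complex.exp (Complex.I * ((μ.arg * m : ℝ) : ℂ)) with hu
  have hun : ‖u‖ = 1 := by rw [hu, mul_comm, Complex.norm_exp_ofReal_mul_I]
  have h2 : ‖u - 1‖ = 2 * |Real.sin (μ.arg * m / 2)| := by
    rw [hu, Complex.norm_exp_I_mul_ofReal_sub_one, norm_mul]
    simp
  have h3 : ‖u - μ ^ m‖ = 1 - ‖μ‖ ^ m := by
    have : u - μ ^ m = ((1 - ‖μ‖ ^ m : ℝ) : ℂ) * u := by rw [h1]; push_cast; ring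
    rw [this, norm_mul, hun, Complex.norm_real, Real.norm_of_nonneg, mul_one]
    have := pow_le_one₀ (n := m) (norm_nonneg μ) hr
    linarith
  have h4 : ‖u - 1‖ ≤ ‖u - μ ^ m‖ + ‖μ ^ m - 1‖ := by
    simpa using norm_add_le (u - μ ^ m) (μ ^ m - 1)
  linarith

lemma norm_log_le {μ : ℂ} {τ : ℝ} (hτ : τ ≤ 1 / 2) (hμ : 1 - τ ≤ ‖μ‖) (hr : ‖μ‖ ≤ 1) :
    ‖Complex.log μ‖ ≤ 2 * τ + |μ.arg| := by
  have hp : 0 < ‖μ‖ := by linarith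
  refine (Complex.norm_le_abs_re_add_abs_im _).trans ?_
  rw [Complex.log_re, Complex.log_im]
  gcongr
  rw [abs_of_nonpos (Real.log_nonpos hp.le hr)]
  have h1 := Real.one_sub_inv_le_log_of_pos hp
  have h2 : ‖μ‖⁻¹ ≤ 1 + 2 * τ := by
    rw [inv_le_iff_one_le_mul₀ hp]
    nlinarith
  linarith

/-- For regular arc lengths, the arc-length model is irreducible and has a spectral gap. -/
theorem RegularLengths.isIrreducible_and_le_spectralGap {k : ℕ} [Nonempty (Fin k)]
    {A : Matrix (Fin k) (Fin k) ℝ} {ℓ : Fin k → ℕ} {M L s η g τ : ℝ}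
    (h : RegularLengths M L s η ℓ)
    (hsymm : A.IsSymm) (hds : A ∈ doublyStochastic ℝ (Fin k)) (hirr : A.IsIrreducible)
    (hg0 : 0 < g) (hg1 : g ≤ 1) (hgap : g ≤ spectralGap A)
    (hL : 1 ≤ L) (hM : 0 ≤ M) (hη0 : 0 < η) (hη1 : η ≤ 1) (hτ0 : 0 ≤ τ) (hτ : τ ≤ 1 / 2)
    (hfar : 160 * (M * τ) < g * η ^ 2) (hnear : 6400 * M ^ 2 * (M * τ) < g * L ^ 2)
    (hlog : (2 * τ + s / L) * M ≤ 1 / 2) :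
    (arcMatrix A ℓ).IsIrreducible ∧ τ ≤ spectralGap (arcMatrix A ℓ) := by
  refine ⟨arcMatrix_isIrreducible hsymm hds hirr hg0 hg1 hgap h.one_le, ?_⟩
  have hε : 0 ≤ M * τ := mul_nonneg hM hτ0
  have hη2 : η ^ 2 ≤ η := by nlinarith
  have hgη : g * η ^ 2 ≤ η ^ 2 := mul_le_of_le_one_left (by positivity) hg1
  have hgg : g * η ^ 2 ≤ g := mul_le_of_le_one_right hg0.le (by nlinarith)
  have hk0 : 0 < k := by
    have : 0 < Fintype.card (Fin k) := Fintype.card_pos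
    rwa [Fintype.card_fin] at this
  obtain ⟨j, hj⟩ : ∃ j, 2 ≤ ℓ j := by
    have := h.long
    obtain ⟨j, hj⟩ := Finset.card_pos.1
      (show 0 < (Finset.univ.filter fun j => L < ℓ j).card by omega)
    have h1 : (1 : ℝ) < ℓ j := hL.trans_lt (Finset.mem_filter.1 hj).2
    exact ⟨j, by exact_mod_cast h1⟩
  obtain ⟨μ₀, hμ₀, hev₀⟩ := exists_eigenvalue_ne_one_arcMatrix hds hj
  refine le_csInf ⟨_, μ₀, hμ₀, hev₀, rfl⟩ ?_
  rintro _ ⟨μ, hμ1, hev, rfl⟩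
  by_contra! hcon
  obtain ⟨x, hx0, hx⟩ := exists_arc_solution_of_hasEigenvalue h.one_le hev
  have hE := arc_solution_energy hsymm hds hirr hg0.le hg1 hgap hx
  have hW := arc_solution_fluctuation hsymm hds hirr hg0.le hg1 hgap hx
  have hr : ‖μ‖ ≤ 1 := arc_solution_norm_le_one hx0 h.one_le (le_trans
    (le_add_of_nonneg_right (mul_nonneg hg0.le
      (Finset.sum_nonneg fun i _ => by positivity))) hE)
  have hpow : ∀ j, 1 - M * τ ≤ ‖μ‖ ^ ℓ j := fun j =>
    one_sub_le_norm_pow hτ0 (by linarith) (by linarith) (h.le_max j)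
  have hZ := arc_solution_near_const hε (by linarith) hpow hE
  have hm := arc_solution_mean_ne_zero hx0 hg0 hZ
  by_cases hθ : s / L ≤ |μ.arg|
  · have hS := arc_solution_sum_pow_sub_one_sq hr hg0 hm hW hZ
    have h1 := not_many_pow_far hg0 hη0 hfar hS
    have h2 := h.spread μ.arg hθ (Complex.abs_arg_le_pi μ)
    have h3 : (Finset.univ.filter fun j => η ≤ |Real.sin (μ.arg * ℓ j / 2)|).card
        ≤ (Finset.univ.filter fun j => η ≤ ‖μ ^ ℓ j - 1‖).card := by
      -- Here `‖μ ^ ℓ j - 1‖ ≥ 2 * η - M * τ`, and `hfar` gives `M * τ ≤ η`.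
      refine Finset.card_le_card (Finset.monotone_filter_right _ fun j _ hj => ?_)
      have := two_mul_abs_sin_le_norm_pow_sub_one hr (ℓ j)
      have := hpow j
      linarith
    omega
  · push Not at hθ
    have hμ0 : μ ≠ 0 := by
      rintro rfl
      simp at hcon
      linarith
    refine not_near_one (M := M) hg0 (by linarith : 0 < L) (Complex.exp_log hμ0) ?_ ?_
      h.le_max h.long hnear hm (arc_solution_sum hds hx) hZ
    · intro h0
      apply hμ1
      rw [← Complex.exp_log hμ0, h0, Complex.exp_zero]
    · refine le_trans ?_ hlog
      gcongr
      exact (norm_log_le hτ (by linarith) hr).trans (by linarith)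

/-! ### The geometric law -/

section Geometric

variable {p : unitInterval}

/-- The memoryless property of the geometric law. -/
lemma geometricMeasure_real_image_add (hp : p ≠ 0) (t : ℕ) (S : Set ℕ) :
    (geometricMeasure p).real ((fun n => n + t) '' S)
      = (1 - p : ℝ) ^ t * (geometricMeasure p).real S := by
  have hq : (0 : ℝ) ≤ 1 - p := sub_nonneg.2 p.2.2
  have h : (geometricMeasure p).comap (fun n => n + t)
      = ENNReal.ofReal ((1 - p : ℝ) ^ t) • geometricMeasure p := by
    refine Measure.ext_of_singleton fun n => ?_
    rw [Measure.comap_apply _ (add_left_injective t) (fun _ _ => .of_discrete) _ .of_discrete,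
      Set.image_singleton, geometricMeasure_singleton hp, Measure.smul_apply,
      geometricMeasure_singleton hp, smul_eq_mul, ← ENNReal.ofReal_mul (by positivity)]
    congr 1
    ring
  have h2 := Measure.comap_apply (fun n => n + t) (add_left_injective t)
    (fun _ _ => .of_discrete) (geometricMeasure p) (MeasurableSet.of_discrete (s := S))
  rw [h, Measure.smul_apply, smul_eq_mul] at h2
  rw [measureReal_def, ← h2, ENNReal.toReal_mul, ENNReal.toReal_ofReal (by positivity),
    measureReal_def]

lemma geometricMeasure_real_tail (hp : p ≠ 0) (t : ℕ) :
    (geometricMeasure p).real {n | t ≤ n} = (1 - p : ℝ) ^ t := by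
  have : {n | t ≤ n} = (fun n => n + t) '' Set.univ := by
    ext n
    simp only [Set.mem_ofPred_eq, Set.image_univ, Set.mem_range]
    exact ⟨fun h => ⟨n - t, by omega⟩, by rintro ⟨y, rfl⟩; omega⟩
  rw [this, geometricMeasure_real_image_add hp]
  simp

/-- A set disjoint from its translate by `t` has geometric mass at most `4/5`, if `t` is at most
of the order of the mean. -/
lemma geometricMeasure_real_le_of_disjoint (hp : p ≠ 0) {t : ℕ} (ht : 1 / 4 ≤ (1 - p : ℝ) ^ t)
    {S : Set ℕ} (hS : ∀ n ∈ S, n + t ∉ S) : (geometricMeasure p).real S ≤ 4 / 5 := by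
  have hd : Disjoint S ((fun n => n + t) '' S) := by
    rw [Set.disjoint_left]
    rintro _ h ⟨n, hn, rfl⟩
    exact hS n hn h
  have h1 := measureReal_union (μ := geometricMeasure p) hd .of_discrete
  have h2 : (geometricMeasure p).real (S ∪ (fun n => n + t) '' S) ≤ 1 := measureReal_le_one
  rw [h1, geometricMeasure_real_image_add hp] at h2
  -- The set and its translate have total mass at least `5/4` of that of `S`.
  nlinarith [measureReal_nonneg (μ := geometricMeasure p) (s := S)]

end Geometric

lemma coe_projIcc_one_div {L : ℝ} (hL : 1 ≤ L) :
    ((Set.projIcc (0 : ℝ) 1 zero_le_one (1 / L) : unitInterval) : ℝ) = 1 / L := by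
  rw [Set.projIcc_of_mem zero_le_one ⟨by positivity, by rw [div_le_one (by linarith)]; exact hL⟩]

lemma projIcc_one_div_ne_zero {L : ℝ} (hL : 1 ≤ L) :
    (Set.projIcc (0 : ℝ) 1 zero_le_one (1 / L) : unitInterval) ≠ 0 := by
  intro h
  have := coe_projIcc_one_div hL
  rw [h] at this
  have h2 : 0 < 1 / L := by positivity
  simp at this
  linarith

instance isProbabilityMeasure_arcLengthLaw (L : ℝ) : IsProbabilityMeasure (arcLengthLaw L) :=
  Measure.isProbabilityMeasure_map (Measurable.of_discrete.aemeasurable)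

instance isProbabilityMeasure_arcLengthsLaw (k : ℕ) (L : ℝ) :
    IsProbabilityMeasure (arcLengthsLaw k L) := by
  unfold arcLengthsLaw; infer_instance

lemma arcLengthLaw_real_apply (L : ℝ) (S : Set ℕ) :
    (arcLengthLaw L).real S
      = (geometricMeasure (Set.projIcc 0 1 zero_le_one (1 / L))).real {n | n + 1 ∈ S} := by
  rw [arcLengthLaw, map_measureReal_apply .of_discrete .of_discrete]
  rfl

lemma arcLengthLaw_real_zero (L : ℝ) : (arcLengthLaw L).real {0} = 0 := by
  rw [arcLengthLaw_real_apply]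
  simp

/-- `1 - 1/L ≥ exp (-1/(L - 1))`, while `L ≥ 5` gives `t / (L - 1) ≤ 5/4`, and `exp (5/4) ≤ 4`. -/
lemma one_fourth_le_pow {L : ℝ} (hL : 5 ≤ L) {t : ℕ} (ht : (t : ℝ) ≤ L) :
    1 / 4 ≤ (1 - 1 / L) ^ t := by
  have hL0 : 0 < L - 1 := by linarith
  have h1 : Real.exp (-(1 / (L - 1))) ≤ 1 - 1 / L := by
    have h2 : 1 - 1 / L = (1 + 1 / (L - 1))⁻¹ := by
      have : L ≠ 0 := by linarith
      field_simp
      ring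
    rw [h2, Real.exp_neg]
    gcongr
    linarith [Real.add_one_le_exp (1 / (L - 1))]
  have h3 : (t : ℝ) * (1 / (L - 1)) ≤ 5 / 4 := by
    rw [mul_one_div, div_le_div_iff₀ hL0 (by norm_num)]
    linarith
  have h4 : Real.exp (5 / 4) ≤ 4 := by
    have h5 : Real.exp (5 / 4) ^ 4 ≤ 4 ^ 4 := by
      rw [← Real.exp_nat_mul]
      have : Real.exp ((4 : ℕ) * (5 / 4)) = Real.exp 1 ^ 5 := by
        rw [← Real.exp_nat_mul]; norm_num
      rw [this]
      calc Real.exp 1 ^ 5 ≤ 2.72 ^ 5 := by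
            gcongr
            linarith [Real.exp_one_lt_d9]
        _ ≤ 4 ^ 4 := by norm_num
    exact le_of_pow_le_pow_left₀ (by norm_num) (by norm_num) h5
  calc (1 : ℝ) / 4 ≤ Real.exp (-(5 / 4)) := by
        rw [Real.exp_neg, one_div]
        gcongr
    _ ≤ Real.exp (t * -(1 / (L - 1))) := by gcongr; linarith
    _ = Real.exp (-(1 / (L - 1))) ^ t := Real.exp_nat_mul _ _
    _ ≤ _ := by gcongr

lemma arcLengthLaw_real_le_of_disjoint {L : ℝ} (hL : 5 ≤ L) {t : ℕ} (ht : (t : ℝ) ≤ L)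
    {S : Set ℕ} (hS : ∀ n ∈ S, 1 ≤ n → n + t ∉ S) : (arcLengthLaw L).real S ≤ 4 / 5 := by
  rw [arcLengthLaw_real_apply]
  refine geometricMeasure_real_le_of_disjoint (projIcc_one_div_ne_zero (by linarith)) (t := t)
    ?_ ?_
  · rw [coe_projIcc_one_div (by linarith)]
    exact one_fourth_le_pow hL ht
  · intro n hn
    have := hS (n + 1) hn (by omega)
    rwa [add_right_comm] at this

/-- The `M - 1` pays for rounding `M` down to an integer. -/
lemma arcLengthLaw_real_tail_le {L M : ℝ} (hL : 1 ≤ L) (hM : 0 ≤ M) :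
    (arcLengthLaw L).real {m | M < m} ≤ Real.exp (-((M - 1) / L)) := by
  have hL1 : 1 / L ≤ 1 := by rw [div_le_one (by linarith)]; exact hL
  rw [arcLengthLaw_real_apply]
  have hsub : {n : ℕ | n + 1 ∈ {m : ℕ | M < m}} ⊆ {n | ⌊M⌋₊ ≤ n} := by
    intro n hn
    have : M < ((n + 1 : ℕ) : ℝ) := hn
    exact Nat.lt_succ_iff.1 ((Nat.floor_lt hM).2 this)
  refine (measureReal_mono hsub).trans ?_
  rw [geometricMeasure_real_tail (projIcc_one_div_ne_zero hL), coe_projIcc_one_div hL]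
  calc (1 - 1 / L) ^ ⌊M⌋₊ ≤ Real.exp (-(1 / L)) ^ ⌊M⌋₊ := by
        gcongr
        linarith [Real.add_one_le_exp (-(1 / L))]
    _ = Real.exp (⌊M⌋₊ * -(1 / L)) := (Real.exp_nat_mul _ _).symm
    _ ≤ _ := by
        gcongr
        have := Nat.lt_floor_add_one M
        have h2 : 0 ≤ 1 / L := by positivity
        have h3 : (M - 1) / L = (M - 1) * (1 / L) := by ring
        rw [h3]
        nlinarith

/-! ### Regularity with high probability -/

/-- A Chernoff bound: if every coordinate fails to satisfy `p` with probability at most `4/5`, then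
with high probability at least a tenth of the coordinates satisfy `p`. -/
lemma pi_real_card_filter_lt {k : ℕ} (ν : Measure ℕ) [IsProbabilityMeasure ν] (p : ℕ → Prop)
    [DecidablePred p] (hS : ν.real {m | ¬ p m} ≤ 4 / 5) :
    (Measure.pi fun _ : Fin k => ν).real
      {ℓ | ¬ k ≤ 10 * (Finset.univ.filter fun j => p (ℓ j)).card} ≤ (97 / 100) ^ k := by
  classical
  set S : Set ℕ := {m | ¬ p m} with hSdef
  set P := Measure.pi fun _ : Fin k => ν
  -- Each bad coordinate gets weight `a`. On failure more than `9 k / 10` are bad, so the product is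
  -- at least `((11/10)^9)^k`; the tenth power keeps exponents integral. The mean weight is at most
  -- `(97/100) * (11/10)^9`.
  set a : ℝ := (11 / 10) ^ 10 with ha
  set f : ℕ → ℝ := fun m => 1 + S.indicator (fun _ => a - 1) m with hf
  have hfi : Integrable f ν := (integrable_const _).add
    ((integrable_const _).indicator .of_discrete)
  have hint : ∫ m, f m ∂ν ≤ 1 + (a - 1) * (4 / 5) := by
    rw [hf, integral_add (integrable_const _) ((integrable_const _).indicator .of_discrete),
      integral_indicator .of_discrete]
    simp only [integral_const, probReal_univ, smul_eq_mul, one_mul, measureReal_restrict_apply_univ]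
    have : 0 ≤ a - 1 := by rw [ha]; norm_num
    nlinarith
  have hf0 : ∀ m, 0 ≤ f m := fun m => by
    simp only [hf, Set.indicator_apply]
    split_ifs <;> norm_num [ha]
  have hprod : ∫ ℓ : Fin k → ℕ, ∏ j, f (ℓ j) ∂P = (∫ m, f m ∂ν) ^ k := by
    rw [integral_fintype_prod_eq_prod (fun _ => f)]
    simp
  have hmarkov := mul_meas_ge_le_integral_of_nonneg (μ := P)
    (f := fun ℓ : Fin k → ℕ => ∏ j, f (ℓ j))
    (.of_forall fun ℓ => Finset.prod_nonneg fun j _ => hf0 _)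
    (Integrable.fintype_prod (f := fun _ : Fin k => f) fun _ => hfi) (((11 / 10) ^ 9) ^ k)
  rw [hprod] at hmarkov
  have hsub : {ℓ : Fin k → ℕ | ¬ k ≤ 10 * (Finset.univ.filter fun j => p (ℓ j)).card}
      ⊆ {ℓ | (((11 : ℝ) / 10) ^ 9) ^ k ≤ ∏ j, f (ℓ j)} := by
    intro ℓ hℓ
    have hcard := Finset.card_filter_add_card_filter_not (s := (Finset.univ : Finset (Fin k)))
      (fun j => ℓ j ∈ S)
    rw [Finset.card_univ, Fintype.card_fin] at hcard
    have hlt : ¬ k ≤ 10 * (Finset.univ.filter fun j => p (ℓ j)).card := hℓ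
    have hfe : ∏ j, f (ℓ j) = a ^ (Finset.univ.filter fun j => ℓ j ∈ S).card := by
      rw [← Finset.prod_const, Finset.prod_filter]
      refine Finset.prod_congr rfl fun j _ => ?_
      simp only [hf, Set.indicator_apply]
      split_ifs <;> ring
    rw [Set.mem_ofPred_eq, hfe, ha, ← pow_mul, ← pow_mul]
    refine pow_le_pow_right₀ (by norm_num) ?_
    have : (Finset.univ.filter fun j => p (ℓ j)).card
        = (Finset.univ.filter fun j => ¬ ℓ j ∈ S).card := by
      congr 1
      ext j
      simp [hSdef]
    omega
  have h1 := measureReal_mono (μ := P) hsub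
  have hint0 : 0 ≤ ∫ m, f m ∂ν := integral_nonneg hf0
  have hb : (0 : ℝ) < ((11 / 10) ^ 9) ^ k := by positivity
  refine h1.trans ?_
  rw [← mul_le_mul_iff_right₀ hb]
  refine hmarkov.trans ?_
  rw [← mul_pow]
  gcongr
  refine hint.trans ?_
  rw [ha]
  norm_num

/-- A multiple of `θ` by at most `L` which is in `[s / 4, π]`. -/
lemma exists_nat_mul_mem {θ L s : ℝ} (hL : 1 ≤ L) (hs : s ≤ 1) (hθ : s / (2 * L) ≤ θ) (hθ0 : 0 < θ)
    (hθπ : θ ≤ Real.pi) : ∃ t : ℕ, (t : ℝ) ≤ L ∧ s / 4 ≤ t * θ ∧ t * θ ≤ Real.pi := by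
  have hfl : (1 : ℝ) ≤ ⌊L⌋₊ := by exact_mod_cast Nat.one_le_floor_iff L |>.2 hL
  -- Take `t = ⌊L⌋ ≥ L / 2` if this does not overshoot `π`; otherwise `t = ⌊π / θ⌋`, for which `t *
  -- θ ≥ π / 2`.
  by_cases h : ⌊L⌋₊ * θ ≤ Real.pi
  · refine ⟨⌊L⌋₊, Nat.floor_le (by linarith), ?_, h⟩
    have h1 : L ≤ 2 * ⌊L⌋₊ := by linarith [Nat.lt_floor_add_one L]
    rw [div_le_iff₀ (by linarith)] at hθ
    nlinarith
  · push Not at h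
    have h1 : (1 : ℝ) ≤ ⌊Real.pi / θ⌋₊ := by
      exact_mod_cast (Nat.one_le_floor_iff _).2 ((one_le_div hθ0).2 hθπ)
    have h2 : (⌊Real.pi / θ⌋₊ : ℝ) ≤ Real.pi / θ := Nat.floor_le (by positivity)
    have h3 : Real.pi / θ < ⌊Real.pi / θ⌋₊ + 1 := Nat.lt_floor_add_one _
    have h4 : Real.pi / θ < ⌊L⌋₊ := (div_lt_iff₀ hθ0).2 h
    refine ⟨⌊Real.pi / θ⌋₊, ?_, ?_, (le_div_iff₀ hθ0).1 h2⟩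
    · linarith [Nat.floor_le (show 0 ≤ L by linarith)]
    · rw [div_lt_iff₀ hθ0] at h3
      nlinarith [Real.pi_gt_three]

/-- If `n` and `n + t` were both bad, the subtraction formula would give `sin (t θ / 2) < 4 η ≤ s /
16`, against Jordan's inequality for `t θ ∈ [s / 4, π]`. -/
lemma arcLengthLaw_real_sin_lt {L s η θ : ℝ} (hL : 5 ≤ L) (hs : s ≤ 1) (hη : 64 * η ≤ s)
    (hθ : s / (2 * L) ≤ θ) (hθ0 : 0 < θ) (hθπ : θ ≤ Real.pi) :
    (arcLengthLaw L).real {m | ¬ 2 * η ≤ |Real.sin (θ * m / 2)|} ≤ 4 / 5 := by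
  obtain ⟨t, htL, ht, htπ⟩ := exists_nat_mul_mem (by linarith) hs hθ hθ0 hθπ
  refine arcLengthLaw_real_le_of_disjoint hL htL fun n hn _ hnt => ?_
  have hn' : |Real.sin (θ * n / 2)| < 2 * η := not_le.1 hn
  have hnt' : |Real.sin (θ * (n + t : ℕ) / 2)| < 2 * η := not_le.1 hnt
  have hsin : s / 16 ≤ Real.sin (t * θ / 2) := by
    have h0 : 0 ≤ t * θ := by positivity
    refine le_trans ?_ (Real.mul_le_sin (by linarith) (by linarith))
    have h1 : 2 / Real.pi * (t * θ / 2) = t * θ / Real.pi := by ring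
    rw [h1, le_div_iff₀ Real.pi_pos]
    have := Real.pi_le_four
    nlinarith
  have hid : Real.sin (t * θ / 2) = Real.sin (θ * (n + t : ℕ) / 2) * Real.cos (θ * n / 2)
      - Real.cos (θ * (n + t : ℕ) / 2) * Real.sin (θ * n / 2) := by
    rw [← Real.sin_sub]
    congr 1
    push_cast
    ring
  have hle : Real.sin (t * θ / 2)
      ≤ |Real.sin (θ * (n + t : ℕ) / 2)| + |Real.sin (θ * n / 2)| := by
    rw [hid]
    refine (le_abs_self _).trans ((abs_sub _ _).trans ?_)
    rw [abs_mul, abs_mul]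
    gcongr
    · exact mul_le_of_le_one_right (abs_nonneg _) (Real.abs_cos_le_one _)
    · exact mul_le_of_le_one_left (abs_nonneg _) (Real.abs_cos_le_one _)
  linarith

lemma arcLengthLaw_real_le_self {L : ℝ} (hL : 5 ≤ L) :
    (arcLengthLaw L).real {m | ¬ L < m} ≤ 4 / 5 := by
  refine arcLengthLaw_real_le_of_disjoint hL (Nat.floor_le (by linarith)) fun n _ hn h => h ?_
  have := Nat.lt_floor_add_one L
  have h1 : (1 : ℝ) ≤ n := by exact_mod_cast hn
  push_cast
  linarith

/-- It suffices to check the spreading of the arc lengths for finitely many angles. -/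
lemma regularLengths_of_grid {k : ℕ} {M L s η : ℝ} {N : ℕ} {ℓ : Fin k → ℕ}
    (hL : 0 < L) (hN0 : 0 < N) (hN : M ≤ 2 * η * N) (hNs : 2 * L ≤ s * N)
    (h1 : ∀ j, 1 ≤ ℓ j) (h2 : ∀ j, (ℓ j : ℝ) ≤ M)
    (h3 : k ≤ 10 * (Finset.univ.filter fun j => L < ℓ j).card)
    (h4 : ∀ h ∈ (Finset.range (4 * N + 1)).filter fun h : ℕ =>
      s / (2 * L) ≤ (h / N : ℝ) ∧ (h / N : ℝ) ≤ Real.pi,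
      k ≤ 10 * (Finset.univ.filter fun j => 2 * η ≤ |Real.sin ((h / N : ℝ) * ℓ j / 2)|).card) :
    RegularLengths M L s η ℓ := by
  refine ⟨h1, h2, h3, fun θ hθ hθπ => ?_⟩
  have hNp : (0 : ℝ) < N := by exact_mod_cast hN0
  -- Rounding `|θ|` down to the grid moves it by at most `1 / N`, hence each sine by at most `M / (2
  -- N) ≤ η`: the threshold `2 η` becomes `η`.
  set h := ⌊|θ| * N⌋₊ with hh
  have hle : (h : ℝ) ≤ |θ| * N := Nat.floor_le (by positivity)
  have hlt : |θ| * N < h + 1 := Nat.lt_floor_add_one _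
  have hdiv : (h / N : ℝ) ≤ |θ| := (div_le_iff₀ hNp).2 hle
  have hdiv2 : |θ| ≤ (h / N : ℝ) + 1 / N := by
    rw [← add_div, le_div_iff₀ hNp]
    exact hlt.le
  have hinv : 1 / (N : ℝ) ≤ s / (2 * L) := by
    rw [div_le_div_iff₀ hNp (by linarith)]
    linarith
  have hmem : h ∈ (Finset.range (4 * N + 1)).filter fun h : ℕ =>
      s / (2 * L) ≤ (h / N : ℝ) ∧ (h / N : ℝ) ≤ Real.pi := by
    refine Finset.mem_filter.2 ⟨Finset.mem_range.2 ?_, ?_, hdiv.trans hθπ⟩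
    · have : (h : ℝ) ≤ (4 * N : ℕ) := by
        push_cast
        nlinarith [Real.pi_le_four]
      exact Nat.lt_succ_of_le (by exact_mod_cast this)
    · have : s / L = s / (2 * L) + s / (2 * L) := by field_simp; ring
      linarith
  refine (h4 h hmem).trans (Nat.mul_le_mul_left _ (Finset.card_le_card
    (Finset.monotone_filter_right _ fun j _ hj => ?_)))
  have habs : |Real.sin (θ * ℓ j / 2)| = |Real.sin (|θ| * ℓ j / 2)| := by
    rcases abs_choice θ with h | h <;> rw [h]
    rw [neg_mul, neg_div, Real.sin_neg, abs_neg]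
  have hd : |Real.sin ((h / N : ℝ) * ℓ j / 2) - Real.sin (|θ| * ℓ j / 2)| ≤ η := by
    refine (Real.abs_sin_sub_sin_le _ _).trans ?_
    have e : (h / N : ℝ) * ℓ j / 2 - |θ| * ℓ j / 2 = -((|θ| - h / N) * (ℓ j / 2)) := by ring
    rw [e, abs_neg, abs_of_nonneg (mul_nonneg (by linarith) (by positivity))]
    calc (|θ| - h / N) * ((ℓ j : ℝ) / 2) ≤ 1 / N * (2 * η * N / 2) := by
          gcongr
          · linarith
          · exact (h2 j).trans hN
      _ = η := by field_simp
  have hj' : 2 * η ≤ |Real.sin ((h / N : ℝ) * ℓ j / 2)| := hj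
  have := abs_sub_abs_le_abs_sub (Real.sin ((h / N : ℝ) * ℓ j / 2)) (Real.sin (|θ| * ℓ j / 2))
  change η ≤ |Real.sin (θ * ℓ j / 2)|
  rw [habs]
  linarith

lemma arcLengthsLaw_real_eval (k : ℕ) (L : ℝ) (j : Fin k) (S : Set ℕ) :
    (arcLengthsLaw k L).real {ℓ | ℓ j ∈ S} = (arcLengthLaw L).real S :=
  (measurePreserving_eval (fun _ : Fin k => arcLengthLaw L) j).measureReal_preimage
    MeasurableSet.of_discrete.nullMeasurableSet

/-- The arc lengths are regular with high probability. -/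
theorem arcLengthsLaw_real_not_regularLengths_le {k : ℕ} {M L s η : ℝ} {N : ℕ}
    (hL : 5 ≤ L) (hM : 0 ≤ M) (hs0 : 0 < s) (hs : s ≤ 1) (hη : 64 * η ≤ s)
    (hN0 : 0 < N) (hN : M ≤ 2 * η * N) (hNs : 2 * L ≤ s * N) :
    (arcLengthsLaw k L).real {ℓ | ¬ RegularLengths M L s η ℓ}
      ≤ k * Real.exp (-((M - 1) / L)) + (4 * N + 2) * (97 / 100) ^ k := by
  set P := arcLengthsLaw k L
  set H := (Finset.range (4 * N + 1)).filter fun h : ℕ =>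
      s / (2 * L) ≤ (h / N : ℝ) ∧ (h / N : ℝ) ≤ Real.pi with hH
  set E1 : Set (Fin k → ℕ) := ⋃ j, {ℓ | ℓ j ∈ ({0} : Set ℕ)}
  set E2 : Set (Fin k → ℕ) := ⋃ j, {ℓ | ℓ j ∈ {m : ℕ | M < m}}
  set E3 : Set (Fin k → ℕ) :=
    {ℓ | ¬ k ≤ 10 * (Finset.univ.filter fun j => L < ℓ j).card}
  set E4 : ℕ → Set (Fin k → ℕ) := fun h =>
    {ℓ | ¬ k ≤ 10 * (Finset.univ.filter fun j =>
      2 * η ≤ |Real.sin ((h / N : ℝ) * ℓ j / 2)|).card}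
  have hsub : {ℓ | ¬ RegularLengths M L s η ℓ} ⊆ E1 ∪ E2 ∪ E3 ∪ ⋃ h ∈ H, E4 h := by
    intro ℓ hℓ
    by_contra hcon
    simp only [Set.mem_union, Set.mem_iUnion, not_or, not_exists, E1, E2, E3, E4,
      Set.mem_ofPred_eq, Set.mem_singleton_iff, not_not, not_lt] at hcon
    obtain ⟨⟨⟨h1, h2⟩, h3⟩, h4⟩ := hcon
    exact hℓ (regularLengths_of_grid (by linarith) hN0 hN hNs
      (fun j => Nat.one_le_iff_ne_zero.2 (h1 j)) h2 h3 h4)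
  have hE1 : P.real E1 ≤ 0 := by
    refine (measureReal_iUnion_fintype_le _).trans (le_of_eq ?_)
    refine Finset.sum_eq_zero fun j _ => ?_
    rw [arcLengthsLaw_real_eval, arcLengthLaw_real_zero]
  have hE2 : P.real E2 ≤ k * Real.exp (-((M - 1) / L)) := by
    refine (measureReal_iUnion_fintype_le _).trans ?_
    calc _ ≤ ∑ _j : Fin k, Real.exp (-((M - 1) / L)) := by
          refine Finset.sum_le_sum fun j _ => ?_
          rw [arcLengthsLaw_real_eval]
          exact arcLengthLaw_real_tail_le (by linarith) hM
      _ = _ := by simp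
  have hE3 : P.real E3 ≤ (97 / 100) ^ k :=
    pi_real_card_filter_lt _ (fun m : ℕ => L < m) (arcLengthLaw_real_le_self hL)
  have hE4 : P.real (⋃ h ∈ H, E4 h) ≤ (4 * N + 1) * (97 / 100) ^ k := by
    refine (measureReal_biUnion_finset_le _ _).trans ?_
    calc _ ≤ ∑ _h ∈ H, ((97 : ℝ) / 100) ^ k := by
          refine Finset.sum_le_sum fun h hh => ?_
          obtain ⟨-, ha, hb⟩ := Finset.mem_filter.1 hh
          refine pi_real_card_filter_lt _
            (fun m : ℕ => 2 * η ≤ |Real.sin ((h / N : ℝ) * m / 2)|) (arcLengthLaw_real_sin_lt hL hs hη ha ?_ hb)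
          exact lt_of_lt_of_le (by positivity) ha
      _ = H.card * (97 / 100) ^ k := by simp
      _ ≤ _ := by
          gcongr
          have : H.card ≤ 4 * N + 1 := (Finset.card_filter_le _ _).trans (by simp)
          exact_mod_cast this
  calc P.real {ℓ | ¬ RegularLengths M L s η ℓ} ≤ P.real (E1 ∪ E2 ∪ E3 ∪ ⋃ h ∈ H, E4 h) :=
        measureReal_mono hsub
    _ ≤ P.real E1 + P.real E2 + P.real E3 + P.real (⋃ h ∈ H, E4 h) := by
        refine (measureReal_union_le _ _).trans ?_
        gcongr
        refine (measureReal_union_le _ _).trans ?_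
        gcongr
        exact measureReal_union_le _ _
    _ ≤ _ := by linarith

/-! ### Choice of parameters and the limit -/

/-- The spectral gap of the arc-length model on regular arc lengths, for large sizes. -/
lemma MemGapClass.of_regularLengths {c α γ L : ℝ} {k : ℕ} {A : Matrix (Fin k) (Fin k) ℝ}
    (hA : MemGapClass c α A) (hc : 0 < c) (hα : 0 ≤ α) (hγ : 7 + α < γ) (hL : 5 ≤ L)
    (hK : 18 ≤ Real.log k) (hcK : 2000000 < min c 1 * Real.log k) {ℓ : Fin k → ℕ}
    (hℓ : RegularLengths (3 * L * Real.log k) L (1 / Real.log k ^ 2)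
      (1 / (64 * Real.log k ^ 2)) ℓ) :
    (arcMatrix A ℓ).IsIrreducible ∧
      1 / (L * Real.log k ^ γ) ≤ spectralGap (arcMatrix A ℓ) := by
  set K := Real.log k with hKdef
  have hK1 : 1 ≤ K := by linarith
  have hK0 : 0 < K := by linarith
  have hL0 : 0 < L := by linarith
  have : Nonempty (Fin k) := by
    refine ⟨⟨0, Nat.pos_of_ne_zero ?_⟩⟩
    rintro rfl
    simp [hKdef] at hK
    linarith
  -- Truncating `c` at `1` keeps the gap parameter `g = d * a` at most `1`.
  set d := min c 1
  have hd0 : 0 < d := lt_min hc one_pos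
  have hd1 : d ≤ 1 := min_le_right _ _
  set a := K ^ (-α) with ha
  set b := K ^ (α - γ) with hb
  have ha0 : 0 < a := Real.rpow_pos_of_pos hK0 _
  have ha1 : a ≤ 1 := Real.rpow_le_one_of_one_le_of_nonpos hK1 (by linarith)
  have hb0 : 0 < b := Real.rpow_pos_of_pos hK0 _
  have hb7 : b * K ^ 7 ≤ 1 := by
    rw [hb, ← Real.rpow_natCast, ← Real.rpow_add hK0]
    exact Real.rpow_le_one_of_one_le_of_nonpos hK1 (by push_cast; linarith)
  have hab : K ^ γ = (a * b)⁻¹ := by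
    rw [ha, hb, ← Real.rpow_add hK0, ← Real.rpow_neg hK0.le]
    congr 1
    ring
  have hτ : 1 / (L * K ^ γ) = a * b / L := by
    rw [hab]
    field_simp
  rw [hτ]
  have hb6 : b * K ^ 5 ≤ 1 / K ^ 2 := by
    rw [le_div_iff₀ (by positivity)]
    linarith
  have hK2 : K ≤ K ^ 2 := by nlinarith
  have hb1 : b ≤ 1 / K ^ 2 := by
    refine le_trans (le_mul_of_one_le_right hb0.le (one_le_pow₀ hK1)) hb6
  have hK21 : 1 / K ^ 2 ≤ 1 := by
    rw [div_le_one (by positivity)]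
    exact one_le_pow₀ hK1
  -- The constant exceeds both `160 * 3 * 64 ^ 2 = 1966080` and `6400 * 27 = 172800`, which arise in
  -- `hfar` and `hnear`.
  have hsmall : 2000000 * (b * K ^ 5) < d := by
    calc 2000000 * (b * K ^ 5) ≤ 2000000 * (1 / K ^ 2) := by gcongr
      _ < d := by
        rw [mul_one_div, div_lt_iff₀ (by positivity)]
        nlinarith
  have hb3 : b * K ^ 3 ≤ b * K ^ 5 := by
    gcongr
    norm_num
  have hMτ : 3 * L * K * (a * b / L) = 3 * a * (b * K) := by field_simp
  have hab1 : a * b ≤ b := mul_le_of_le_one_left hb0.le ha1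
  refine hℓ.isIrreducible_and_le_spectralGap (g := d * a) hA.symm hA.doublyStochastic
    hA.irreducible (by positivity) (mul_le_one₀ hd1 ha0.le ha1) ?_ (by linarith) (by positivity)
    (by positivity) ?_ (by positivity) ?_ ?_ ?_ ?_
  · refine le_trans ?_ hA.gap
    gcongr
    exact min_le_left _ _
  · rw [div_le_one (by positivity)]
    linarith
  · rw [div_le_iff₀ hL0]
    linarith
  · rw [hMτ, div_pow, one_pow, mul_one_div, lt_div_iff₀ (by positivity)]
    calc 160 * (3 * a * (b * K)) * (64 * K ^ 2) ^ 2 = a * (1966080 * (b * K ^ 5)) := by ring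
      _ < a * d := by
        gcongr
        have : 0 < b * K ^ 5 := by positivity
        linarith
      _ = d * a := mul_comm _ _
  · rw [hMτ]
    calc 6400 * (3 * L * K) ^ 2 * (3 * a * (b * K)) = a * (172800 * (b * K ^ 3)) * L ^ 2 := by ring
      _ < a * d * L ^ 2 := by
        gcongr
        have : 0 < b * K ^ 5 := by positivity
        linarith
      _ = d * a * L ^ 2 := by ring
  · have e : (2 * (a * b / L) + 1 / K ^ 2 / L) * (3 * L * K) = 6 * (a * b) * K + 3 / K := by
      field_simp
      ring
    rw [e]
    have h1 : 6 * (a * b) * K ≤ 6 / K := by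
      calc 6 * (a * b) * K ≤ 6 * (1 / K ^ 2) * K := by
            gcongr
            exact hab1.trans hb1
        _ = 6 / K := by field_simp
    have h2 : 6 / K + 3 / K ≤ 1 / 2 := by
      rw [← add_div, div_le_iff₀ hK0]
      linarith
    linarith

/-- The failure probability of regularity for arc lengths of polynomial mean. -/
lemma arcLengthsLaw_real_not_regularLengths_le_of_log {k : ℕ} {L ρ : ℝ} (hL : 5 ≤ L)
    (hK : 1 ≤ Real.log k) (hLk : Real.log L ≤ ρ * Real.log k) :
    (arcLengthsLaw k L).real {ℓ | ¬ RegularLengths (3 * L * Real.log k) L (1 / Real.log k ^ 2)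
      (1 / (64 * Real.log k ^ 2)) ℓ}
      ≤ 1 / k + 400 * ((k : ℝ) ^ (ρ + 3) * (97 / 100) ^ k) := by
  set K := Real.log k with hKdef
  have hL0 : 0 < L := by linarith
  have hk0 : (0 : ℝ) < k := by
    rcases Nat.eq_zero_or_pos k with rfl | h
    · simp [hKdef] at hK
      linarith
    · exact_mod_cast h
  have hX : 0 ≤ 96 * L * K ^ 3 := by positivity
  -- `M ≤ 2 η N` with `M = 3 L K` and `η = 1 / (64 K ^ 2)` amounts to `N ≥ 96 L K ^ 3`.
  set N := ⌈96 * L * K ^ 3⌉₊ with hN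
  have hN1 : 96 * L * K ^ 3 ≤ N := Nat.le_ceil _
  have hN2 : (N : ℝ) < 96 * L * K ^ 3 + 1 := Nat.ceil_lt_add_one hX
  have hK2 : 1 ≤ K ^ 2 := one_le_pow₀ hK
  have hK3 : 1 ≤ K ^ 3 := one_le_pow₀ hK
  have hK23 : K ^ 2 ≤ K ^ 3 := pow_le_pow_right₀ hK (by norm_num)
  have hLK : 5 ≤ L * K ^ 3 := by nlinarith
  have hN0 : 0 < N := by
    have : (0 : ℝ) < N := by nlinarith
    exact_mod_cast this
  refine (arcLengthsLaw_real_not_regularLengths_le (N := N) hL (by positivity) (by positivity)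
    ((div_le_one (by positivity)).2 hK2) (le_of_eq (by field_simp)) hN0 ?_ ?_).trans ?_
  · have e : 2 * (1 / (64 * K ^ 2)) * (N : ℝ) = N / (32 * K ^ 2) := by field_simp; norm_num
    rw [e, le_div_iff₀ (by positivity)]
    linarith
  · rw [one_div_mul_eq_div, le_div_iff₀ (by positivity)]
    nlinarith
  · have hLpow : L ≤ (k : ℝ) ^ ρ := by
      rw [Real.rpow_def_of_pos hk0, ← Real.log_le_iff_le_exp hL0]
      linarith
    have hKk : K ≤ k := (Real.log_le_sub_one_of_pos hk0).trans (by linarith)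
    refine add_le_add ?_ ?_
    · have h1 : 2 * K ≤ (3 * L * K - 1) / L := by
        rw [le_div_iff₀ hL0]
        nlinarith
      calc k * Real.exp (-((3 * L * K - 1) / L)) ≤ k * Real.exp (-(2 * K)) := by gcongr
        _ = 1 / k := by
          rw [Real.exp_neg, two_mul, Real.exp_add, hKdef, Real.exp_log hk0]
          field_simp
    · rw [← mul_assoc]
      refine mul_le_mul_of_nonneg_right ?_ (by positivity)
      have e : (k : ℝ) ^ (ρ + 3) = (k : ℝ) ^ ρ * (k : ℝ) ^ 3 := by
        rw [Real.rpow_add hk0]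
        norm_cast
      rw [e]
      calc 4 * (N : ℝ) + 2 ≤ 400 * (L * K ^ 3) := by linarith
        _ ≤ _ := by gcongr

lemma tendsto_failure_bound {k : ℕ → ℕ} (hk : Tendsto k atTop atTop) (ρ : ℝ) :
    Tendsto (fun n => 1 / (k n : ℝ) + 400 * ((k n : ℝ) ^ (ρ + 3) * (97 / 100) ^ k n))
      atTop (𝓝 0) := by
  have hkR : Tendsto (fun n => (k n : ℝ)) atTop atTop := tendsto_natCast_atTop_atTop.comp hk
  have h1 : Tendsto (fun n => 1 / (k n : ℝ)) atTop (𝓝 0) := hkR.const_div_atTop 1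
  have hlog : 0 < -Real.log (97 / 100) := by
    have := Real.log_neg (show (0 : ℝ) < 97 / 100 by norm_num) (by norm_num)
    linarith
  have h2 := (tendsto_rpow_mul_exp_neg_mul_atTop_nhds_zero (ρ + 3) _ hlog).comp hkR
  have h3 : Tendsto (fun n => (k n : ℝ) ^ (ρ + 3) * (97 / 100 : ℝ) ^ k n) atTop (𝓝 0) := by
    refine h2.congr fun n => ?_
    simp only [Function.comp_apply, neg_neg]
    rw [mul_comm (Real.log _), Real.exp_nat_mul, Real.exp_log (by norm_num)]
  simpa using h1.add (h3.const_mul 400)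

end

theorem theorem1 (c α ρl ρu γ : ℝ) (hc : 0 < c) (hα : 0 ≤ α) (hρl : 0 < ρl) (hρ : ρl < ρu)
    (hγ : 7 + α < γ)
    (k : ℕ → ℕ) (L : ℕ → ℝ) (hk : Tendsto k atTop atTop) (hL : Tendsto L atTop atTop)
    (hkL : ∀ᶠ n in atTop, ρl < Real.log (L n) / Real.log (k n) ∧
      Real.log (L n) / Real.log (k n) < ρu)
    (A : ∀ n, Matrix (Fin (k n)) (Fin (k n)) ℝ) (hA : ∀ᶠ n in atTop, MemGapClass c α (A n)) :
    Tendsto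
      (fun n => arcLengthsLaw (k n) (L n)
        {ℓ : Fin (k n) → ℕ | (arcMatrix (A n) ℓ).IsIrreducible ∧
          1 / (L n * Real.log (k n) ^ γ) ≤ spectralGap (arcMatrix (A n) ℓ)})
      atTop (𝓝 1) := by
  have hlog : Tendsto (fun n => Real.log (k n)) atTop atTop :=
    Real.tendsto_log_atTop.comp (tendsto_natCast_atTop_atTop.comp hk)
  have hbound := ENNReal.tendsto_ofReal (tendsto_failure_bound hk ρu)
  rw [ENNReal.ofReal_zero] at hbound
  have hlower := ENNReal.Tendsto.sub (tendsto_const_nhds (x := (1 : ENNReal))) hbound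
    (Or.inl ENNReal.one_ne_top)
  rw [tsub_zero] at hlower
  refine tendsto_of_tendsto_of_tendsto_of_le_of_le' hlower tendsto_const_nhds ?_
    (.of_forall fun n => prob_le_one)
  filter_upwards [hkL, hA, hL.eventually_ge_atTop 5, hlog.eventually_ge_atTop 18,
    (hlog.const_mul_atTop (lt_min hc one_pos)).eventually_gt_atTop 2000000]
    with n hkLn hAn hLn hKn hcKn
  set R : Set (Fin (k n) → ℕ) := {ℓ | RegularLengths (3 * L n * Real.log (k n)) (L n)
    (1 / Real.log (k n) ^ 2) (1 / (64 * Real.log (k n) ^ 2)) ℓ}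
  have hfail : arcLengthsLaw (k n) (L n) Rᶜ ≤ ENNReal.ofReal
      (1 / (k n : ℝ) + 400 * ((k n : ℝ) ^ (ρu + 3) * (97 / 100) ^ k n)) := by
    rw [← ofReal_measureReal]
    refine ENNReal.ofReal_le_ofReal
      (arcLengthsLaw_real_not_regularLengths_le_of_log hLn (by linarith) ?_)
    exact ((div_lt_iff₀ (by linarith)).1 hkLn.2).le
  -- Subadditivity suffices here, without measurability of `R`.
  have htotal : 1 ≤ arcLengthsLaw (k n) (L n) R + arcLengthsLaw (k n) (L n) Rᶜ := by
    rw [← measure_univ (μ := arcLengthsLaw (k n) (L n)), ← Set.union_compl_self R]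
    exact measure_union_le _ _
  refine le_trans ?_ (measure_mono fun ℓ (hℓ : ℓ ∈ R) =>
    hAn.of_regularLengths hc hα hγ hLn hKn hcKn hℓ)
  rw [tsub_le_iff_right]
  exact htotal.trans (by gcongr)
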